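/- Let $k$ be a field and $G$ a group. A $k$-category is a category whose morphism sets are $k$-vector spaces and whose composition is $k$-bilinear. A $G$-$k$-category is a $k$-category $\mathcal C$ with a (strict) action of $G$ by $k$-linear automorphisms: $G$ acts on the set of objects, each $s\in G$ gives $k$-linear maps $\mathcal C(x,y)\to\mathcal C(sx,sy)$, $f\mapsto sf$, compatible with composition and identities, and $1f=f$, $(st)f=s(tf)$. For a $k$-category $\mathcal C$ let $C^\bullet(\mathcal C)$ be the Hochschild–Mitchell cochain complex, $$C^n(\mathcal C)=\prod_{x_{n+1},\dots,x_1}\mathrm{Hom}_k\big(\mathcal C(x_n,x_{n+1})\otimes_k\cdots\otimes_k\mathcal C(x_1,x_2),\ \mathcal C(x_1,x_{n+1})\big)\quad(n>0),\qquad C^0(\mathcal C)=\prod_x\mathcal C(x,x),$$ with coboundary $$(d\varphi)(f_{n+1}\otimes\cdots\otimes f_1)=(-1)^{n+1}f_{n+1}\varphi(f_n\otimes\cdots\otimes f_1)+\sum_{i=1}^n(-1)^i\varphi(f_{n+1}\otimes\cdots\otimes f_{i+1}f_i\otimes\cdots\otimes f_1)+\varphi(f_{n+1}\otimes\cdots\otimes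 f_2)f_1 ,$$ and cup product $(\psi\smile\varphi)(f_{m+n}\otimes\cdots\otimes f_1)=\psi(f_{m+n}\otimes\cdots\otimes f_{n+1})\,\varphi(f_n\otimes\cdots\otimes f_1)$ for $\psi\in C^m(\mathcal C)$, $\varphi\in C^n(\mathcal C)$; its unit is the family $(1_x)_x\in C^0(\mathcal C)$. The cup product makes $HH^\bullet(\mathcal C)=\bigoplus_n H^n(C^\bullet(\mathcal C))$ a graded $k$-algebra. If $\mathcal C$ is a $G$-$k$-category, $G$ acts on $C^n(\mathcal C)$ by $(s\varphi)(f_n\otimes\cdots\otimes f_1)=s\big(\varphi(s^{-1}f_n\otimes\cdots\otimes s^{-1}f_1)\big)$ (and by $(s\varphi)_{sx}=s(\varphi_x)$ for $n=0$), and this induces an action of $G$ on $HH^\bullet(\mathcal C)$ by $k$-algebra automorphisms. **Theorem.** Let $\mathcal C$ and $\mathcal D$ be $G$-$k$-categories and let $F:\mathcal C\to\mathcal D$ be an equivalence of $G$-$k$-categories, that is, a $k$-linear functor which is an equivalence of categories and which satisfies $F(sx)=sF(x)$ and $F(sf)=sF(f)$ for all $s\in G$, all objects $x$ and all morphisms $f$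 of $\mathcal C$. For $\varphi\in C^n(\mathcal D)$ define $C^nF(\varphi)\in C^n(\mathcal C)$ by $$\big(C^nF(\varphi)\big)_{x_{n+1},\dots,x_1}(f_n\otimes\cdots\otimes f_1)=F^{-1}\Big(\varphi_{F(x_{n+1}),\dots,F(x_1)}\big(F(f_n)\otimes\cdots\otimes F(f_1)\big)\Big),$$ where $F^{-1}$ is the inverse of the $k$-isomorphism $\mathcal C(x_1,x_{n+1})\to\mathcal D(F(x_1),F(x_{n+1}))$ given by $F$. Then $C^\bullet F:C^\bullet(\mathcal D)\to C^\bullet(\mathcal C)$ is a map of cochain complexes, it is unital and multiplicative for the cup products, and it commutes with the actions of $G$. The map which it induces in cohomology is an isomorphism of graded $k$-algebras $HH^\bullet(\mathcal D)\to HH^\bullet(\mathcal C)$ which commutes with the actions of $G$. -/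

import Mathlib

open CategoryTheory

set_option linter.unusedSectionVars false
set_option linter.unusedSimpArgs false
set_option linter.unusedVariables false

noncomputable section

namespace HochschildMitchell

universe w g u v u₁ v₁ u₂ v₂

/-- A map on a finite product of modules which is linear in each variable, as a bundled
multilinear map. -/
def mkMulti {k : Type*} [CommRing k] {n : ℕ} {M : Fin n → Type*} {N : Type*}
    [∀ i, AddCommGroup (M i)] [∀ i, Module k (M i)] [AddCommGroup N] [Module k N]
    (T : (∀ i, M i) → N)
    (h : ∀ (f : ∀ i, M i) (i : Fin n), ∃ L : M i →ₗ[k] N,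
      ∀ c, T (Function.update f i c) = L c) : MultilinearMap k M N where
  toFun := T
  map_update_add' := by
    intro inst f i c c'
    obtain rfl : inst = instDecidableEqFin n := Subsingleton.elim _ _
    obtain ⟨L, hL⟩ := h f i
    simp [hL]
  map_update_smul' := by
    intro inst f i a c
    obtain rfl : inst = instDecidableEqFin n := Subsingleton.elim _ _
    obtain ⟨L, hL⟩ := h f i
    simp [hL]

section Paths

variable {C : Type u} [Category.{v} C]

theorem comp_heq {x y z x' y' z' : C} {f : x ⟶ y} {f' : x' ⟶ y'} {h : y ⟶ z} {h' : y' ⟶ z'}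
    (hx : x = x') (hy : y = y') (hz : z = z') (hf : f ≍ f') (hh : h ≍ h') :
    f ≫ h ≍ f' ≫ h' := by
  subst hx hy hz
  obtain rfl := eq_of_heq hf
  obtain rfl := eq_of_heq hh
  rfl

theorem arrow_heq {n : ℕ} {x : Fin (n + 1) → C} (f : ∀ i : Fin n, (x i.succ ⟶ x i.castSucc))
    {i j : Fin n} (h : i.1 = j.1) : f i ≍ f j := by
  obtain rfl : i = j := Fin.ext h
  rfl

/-- Deletion of the inner object at position `j + 1`. -/
def mergeObj {n : ℕ} (x : Fin (n + 2) → C) (j : Fin n) : Fin (n + 1) → C :=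
  fun a => x (j.castSucc.succ.succAbove a)

theorem mergeObj_lt {n : ℕ} (x : Fin (n + 2) → C) (j : Fin n) (a : Fin (n + 1))
    (h : a.1 ≤ j.1) : mergeObj x j a = x a.castSucc := by
  unfold mergeObj
  rw [Fin.succAbove_of_castSucc_lt]
  simp only [Fin.lt_def, Fin.val_castSucc, Fin.val_succ]; omega

theorem mergeObj_gt {n : ℕ} (x : Fin (n + 2) → C) (j : Fin n) (a : Fin (n + 1))
    (h : j.1 < a.1) : mergeObj x j a = x a.succ := by
  unfold mergeObj
  rw [Fin.succAbove_of_le_castSucc]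
  simp only [Fin.le_def, Fin.val_castSucc, Fin.val_succ]; omega

end Paths

section Cochains

variable (k : Type w) [CommRing k] (C : Type u) [Category.{v} C] [Preadditive C] [Linear k C]

/-- Hochschild-Mitchell cochains of degree `n` of a `k`-linear category: families indexed by the
sequences `x 0, …, x n` of objects of multilinear maps, equivalently of linear maps on the tensor
product of the spaces of morphisms `x 1 ⟶ x 0`, …, `x n ⟶ x (n - 1)`, with values in the
morphisms `x n ⟶ x 0`. The indexing follows the order of composition of functions: the arguments
`f 0, f 1, …, f (n - 1)` are composable as `f 0 ∘ f 1 ∘ ⋯ ∘ f (n - 1)`. In degree zero this is the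
product of the endomorphism spaces. -/
def Cochain (n : ℕ) : Type (max u v) :=
  ∀ x : Fin (n + 1) → C,
    MultilinearMap k (fun i : Fin n => (x i.succ ⟶ x i.castSucc)) (x (Fin.last n) ⟶ x 0)

instance (n : ℕ) : AddCommGroup (Cochain k C n) :=
  inferInstanceAs (AddCommGroup (∀ x : Fin (n + 1) → C,
    MultilinearMap k (fun i : Fin n => (x i.succ ⟶ x i.castSucc)) (x (Fin.last n) ⟶ x 0)))

instance (n : ℕ) : Module k (Cochain k C n) :=
  inferInstanceAs (Module k (∀ x : Fin (n + 1) → C,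
    MultilinearMap k (fun i : Fin n => (x i.succ ⟶ x i.castSucc)) (x (Fin.last n) ⟶ x 0)))

variable {k C}

theorem Cochain.ext {n : ℕ} {φ φ' : Cochain k C n} (h : ∀ x f, φ x f = φ' x f) : φ = φ' :=
  funext fun x => MultilinearMap.ext (h x)

theorem Cochain.add_apply {n : ℕ} (φ φ' : Cochain k C n) (x : Fin (n + 1) → C)
    (f : ∀ i : Fin n, (x i.succ ⟶ x i.castSucc)) : (φ + φ') x f = φ x f + φ' x f := rfl

theorem Cochain.smul_apply {n : ℕ} (c : k) (φ : Cochain k C n) (x : Fin (n + 1) → C)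
    (f : ∀ i : Fin n, (x i.succ ⟶ x i.castSucc)) : (c • φ) x f = c • φ x f := rfl

/-- Evaluation of cochains, as a linear map. -/
def Cochain.evalₗ {n : ℕ} (x : Fin (n + 1) → C) (f : ∀ i : Fin n, (x i.succ ⟶ x i.castSucc)) :
    Cochain k C n →ₗ[k] (x (Fin.last n) ⟶ x 0) where
  toFun φ := φ x f
  map_add' _ _ := rfl
  map_smul' _ _ := rfl

theorem Cochain.sum_apply {n : ℕ} {ι : Type*} (s : Finset ι) (φ : ι → Cochain k C n)
    (x : Fin (n + 1) → C) (f : ∀ i : Fin n, (x i.succ ⟶ x i.castSucc)) :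
    (∑ i ∈ s, φ i) x f = ∑ i ∈ s, φ i x f :=
  map_sum (Cochain.evalₗ x f) φ s

/-- Evaluation of a cochain is compatible with equalities of sequences of objects. -/
theorem cochain_heq {n : ℕ} (φ : Cochain k C n) {x x' : Fin (n + 1) → C}
    {f : ∀ i : Fin n, (x i.succ ⟶ x i.castSucc)} {f' : ∀ i : Fin n, (x' i.succ ⟶ x' i.castSucc)}
    (hx : ∀ i, x i = x' i) (hf : ∀ i, f i ≍ f' i) : φ x f ≍ φ x' f' := by
  obtain rfl : x = x' := funext hx
  obtain rfl : f = f' := funext fun i => eq_of_heq (hf i)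
  rfl

/-- Replacement of the consecutive morphisms `f j` and `f (j + 1)` by their composite
`f j ∘ f (j + 1)`. The `eqToHom`s only identify the source and the target of each morphism. -/
def mergeHom {n : ℕ} (x : Fin (n + 2) → C) (f : ∀ i : Fin (n + 1), (x i.succ ⟶ x i.castSucc))
    (j a : Fin n) : (mergeObj x j a.succ ⟶ mergeObj x j a.castSucc) :=
  if h : a < j then
    eqToHom (mergeObj_lt x j a.succ h) ≫ f a.castSucc ≫
      eqToHom (mergeObj_lt x j a.castSucc h.le).symm
  else if h' : a = j then
    eqToHom (mergeObj_gt x j a.succ (by simp [h'])) ≫ (f a.succ ≫ f a.castSucc) ≫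
      eqToHom (mergeObj_lt x j a.castSucc (by simp [h'])).symm
  else
    eqToHom (mergeObj_gt x j a.succ (by simp; omega)) ≫ f a.succ ≫
      eqToHom (mergeObj_gt x j a.castSucc (by simp; omega)).symm

theorem mergeHom_lt {n : ℕ} (x : Fin (n + 2) → C)
    (f : ∀ i : Fin (n + 1), (x i.succ ⟶ x i.castSucc)) (j a : Fin n) (h : a.1 < j.1) :
    mergeHom x f j a ≍ f a.castSucc := by
  unfold mergeHom
  rw [dif_pos (Fin.lt_def.2 h)]
  simp

theorem mergeHom_eq {n : ℕ} (x : Fin (n + 2) → C)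
    (f : ∀ i : Fin (n + 1), (x i.succ ⟶ x i.castSucc)) (j a : Fin n) (h : a.1 = j.1) :
    mergeHom x f j a ≍ f a.succ ≫ f a.castSucc := by
  unfold mergeHom
  rw [dif_neg (by rw [Fin.lt_def]; omega), dif_pos (Fin.ext h), eqToHom_comp_heq_iff]
  exact comp_eqToHom_heq _ _

theorem mergeHom_gt {n : ℕ} (x : Fin (n + 2) → C)
    (f : ∀ i : Fin (n + 1), (x i.succ ⟶ x i.castSucc)) (j a : Fin n) (h : j.1 < a.1) :
    mergeHom x f j a ≍ f a.succ := by
  unfold mergeHom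
  rw [dif_neg (by rw [Fin.lt_def]; omega), dif_neg (by rw [Fin.ext_iff]; omega)]
  simp

/-- Composition with fixed morphisms on both sides, as a linear map. -/
def sandwich (k : Type w) [CommRing k] [Linear k C] {a b c d : C} (p : a ⟶ b) (q : c ⟶ d) :
    (b ⟶ c) →ₗ[k] (a ⟶ d) :=
  (Linear.leftComp k d p).comp (Linear.rightComp k b q)

theorem mergeHom_update (k : Type w) [CommRing k] [Linear k C] {n : ℕ} (x : Fin (n + 2) → C)
    (f : ∀ i : Fin (n + 1), (x i.succ ⟶ x i.castSucc)) (j : Fin n) (i : Fin (n + 1)) :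
    ∃ (a : Fin n) (L : (x i.succ ⟶ x i.castSucc) →ₗ[k]
        (mergeObj x j a.succ ⟶ mergeObj x j a.castSucc)),
      ∀ c, mergeHom x (Function.update f i c) j =
        Function.update (mergeHom x f j) a (L c) := by
  have key : ∀ (a : Fin n) (L : (x i.succ ⟶ x i.castSucc) →ₗ[k]
        (mergeObj x j a.succ ⟶ mergeObj x j a.castSucc)),
      (∀ c, mergeHom x (Function.update f i c) j a = L c) →
      (∀ b, b ≠ a → b < j → b.castSucc ≠ i) → 
      (∀ b, b ≠ a → b = j → b.castSucc ≠ i ∧ b.succ ≠ i) →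
      (∀ b, b ≠ a → j < b → b.succ ≠ i) → 
      ∃ (a : Fin n) (L : (x i.succ ⟶ x i.castSucc) →ₗ[k]
        (mergeObj x j a.succ ⟶ mergeObj x j a.castSucc)),
      ∀ c, mergeHom x (Function.update f i c) j =
        Function.update (mergeHom x f j) a (L c) := by
    intro a L hL h1 h2 h3
    refine ⟨a, L, fun c => ?_⟩
    funext b
    by_cases hb : b = a
    · subst hb; simp [hL]
    · rw [Function.update_of_ne hb]
      unfold mergeHom
      split_ifs with h h'
      · rw [Function.update_of_ne (h1 b hb h)]
      · rw [Function.update_of_ne (h2 b hb h').1, Function.update_of_ne (h2 b hb h').2]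
      · rw [Function.update_of_ne (h3 b hb (by omega))]
  rcases lt_trichotomy i.1 j.1 with h | h | h
  · obtain ⟨b, rfl⟩ : ∃ b : Fin n, i = b.castSucc := ⟨⟨i, by omega⟩, rfl⟩
    refine key b (sandwich k (eqToHom (mergeObj_lt x j b.succ h))
      (eqToHom (mergeObj_lt x j b.castSucc h.le).symm)) (fun c => ?_) ?_ ?_ ?_
    · unfold mergeHom
      rw [dif_pos (Fin.lt_def.2 h)]
      simp [sandwich]
    all_goals simp only [ne_eq, Fin.ext_iff, Fin.lt_def, Fin.val_castSucc, Fin.val_succ] at h ⊢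
    all_goals intros; omega
  · obtain rfl : i = j.castSucc := Fin.ext h
    refine key j (sandwich k (eqToHom (mergeObj_gt x j j.succ (by simp)) ≫ f j.succ)
      (eqToHom (mergeObj_lt x j j.castSucc (by simp)).symm)) (fun c => ?_) ?_ ?_ ?_
    · unfold mergeHom
      rw [dif_neg (lt_irrefl _), dif_pos rfl, Function.update_of_ne (by simp [Fin.ext_iff])]
      simp [sandwich]
    all_goals simp only [ne_eq, Fin.ext_iff, Fin.lt_def, Fin.val_castSucc, Fin.val_succ] at h ⊢
    all_goals intros; omega
  · obtain ⟨b, rfl⟩ : ∃ b : Fin n, i = b.succ := ⟨⟨i - 1, by omega⟩, by ext; simp; omega⟩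
    rcases eq_or_ne b j with rfl | hne
    · refine key b (sandwich k (eqToHom (mergeObj_gt x b b.succ (by simp)))
        (f b.castSucc ≫ eqToHom (mergeObj_lt x b b.castSucc (by simp)).symm)) (fun c => ?_) ?_ ?_ ?_
      · unfold mergeHom
        rw [dif_neg (lt_irrefl _), dif_pos rfl,
          Function.update_of_ne (a := b.castSucc) (a' := b.succ) (by simp [Fin.ext_iff])]
        simp [sandwich]
      all_goals simp only [ne_eq, Fin.ext_iff, Fin.lt_def, Fin.val_castSucc, Fin.val_succ] at h ⊢
      all_goals intros; omega
    · have h' : j.1 < b.1 := by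
        simp only [ne_eq, Fin.ext_iff, Fin.val_succ] at h hne; omega
      refine key b (sandwich k (eqToHom (mergeObj_gt x j b.succ (by simp; omega)))
        (eqToHom (mergeObj_gt x j b.castSucc (by simp; omega)).symm)) (fun c => ?_) ?_ ?_ ?_
      · unfold mergeHom
        rw [dif_neg (by rw [Fin.lt_def]; omega), dif_neg hne]
        simp [sandwich]
      all_goals simp only [ne_eq, Fin.ext_iff, Fin.lt_def, Fin.val_castSucc, Fin.val_succ] at h ⊢
      all_goals intros; omega

/-- `f₀, …, fₙ ↦ f₀ ∘ φ(f₁, …, fₙ)`. -/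
def dLeft {n : ℕ} (φ : Cochain k C n) : Cochain k C (n + 1) := fun x =>
  mkMulti (fun f => φ (fun i => x i.succ) (fun i => f i.succ) ≫ f 0) (by
    intro f i
    refine Fin.cases ?_ (fun i => ?_) i
    · refine ⟨Linear.leftComp k _ (φ (fun i => x i.succ) (fun i => f i.succ)), fun c => ?_⟩
      simp
      rfl
    · refine ⟨(Linear.rightComp k (x (Fin.last n).succ) (f 0)).comp
        ((φ (fun i => x i.succ)).toLinearMap (fun i => f i.succ) i), fun c => ?_⟩
      have : (fun j : Fin n => Function.update f i.succ c j.succ) =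
          Function.update (fun j : Fin n => f j.succ) i c := by
        funext j
        by_cases h : j = i
        · subst h; simp
        · simp [Function.update_of_ne h, h]
      simp only [this]
      rw [Function.update_of_ne (Fin.succ_ne_zero i).symm]
      rfl)

/-- `f₀, …, fₙ ↦ φ(f₀, …, fₙ₋₁) ∘ fₙ`. -/
def dRight {n : ℕ} (φ : Cochain k C n) : Cochain k C (n + 1) := fun x =>
  mkMulti (fun f => f (Fin.last n) ≫ φ (fun i => x i.castSucc) (fun i => f i.castSucc)) (by
    intro f i
    refine Fin.lastCases ?_ (fun i => ?_) i
    · refine ⟨Linear.rightComp k _ (φ (fun i => x i.castSucc) (fun i => f i.castSucc)),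
        fun c => ?_⟩
      have : (fun j : Fin n => Function.update f (Fin.last n) c j.castSucc) =
          (fun j : Fin n => f j.castSucc) := by
        funext j
        simp [Function.update_of_ne (Fin.castSucc_ne_last j)]
      simp [Linear.rightComp, this]
    · refine ⟨(Linear.leftComp k (x 0) (f (Fin.last n))).comp
        ((φ (fun i => x i.castSucc)).toLinearMap (fun i => f i.castSucc) i), fun c => ?_⟩
      have : (fun j : Fin n => Function.update f i.castSucc c j.castSucc) =
          Function.update (fun j : Fin n => f j.castSucc) i c := by
        funext j
        by_cases h : j = i
        · subst h; simp
        · simp [Function.update_of_ne h, h]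
      simp only [this]
      rw [Function.update_of_ne (Fin.castSucc_ne_last i).symm]
      rfl)

/-- `f₀, …, fₙ ↦ φ(f₀, …, fⱼ ∘ fⱼ₊₁, …, fₙ)`. -/
def dMiddle {n : ℕ} (j : Fin n) (φ : Cochain k C n) : Cochain k C (n + 1) := fun x =>
  mkMulti (fun f => eqToHom (mergeObj_gt x j (Fin.last n) j.2).symm ≫
      φ (mergeObj x j) (mergeHom x f j) ≫ eqToHom (mergeObj_lt x j 0 (Nat.zero_le _))) (by
    intro f i
    obtain ⟨a, L, hL⟩ := mergeHom_update k x f j i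
    refine ⟨((sandwich k (eqToHom (mergeObj_gt x j (Fin.last n) j.2).symm)
      (eqToHom (mergeObj_lt x j 0 (Nat.zero_le _)))).comp
      ((φ (mergeObj x j)).toLinearMap (mergeHom x f j) a)).comp L, fun c => ?_⟩
    rw [hL]
    rfl)

theorem dLeft_apply {n : ℕ} (φ : Cochain k C n) (x : Fin (n + 2) → C)
    (f : ∀ i : Fin (n + 1), (x i.succ ⟶ x i.castSucc)) :
    dLeft φ x f = φ (fun i => x i.succ) (fun i => f i.succ) ≫ f 0 := rfl

theorem dRight_apply {n : ℕ} (φ : Cochain k C n) (x : Fin (n + 2) → C)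
    (f : ∀ i : Fin (n + 1), (x i.succ ⟶ x i.castSucc)) :
    dRight φ x f = f (Fin.last n) ≫ φ (fun i => x i.castSucc) (fun i => f i.castSucc) := rfl

theorem dMiddle_heq {n : ℕ} (j : Fin n) (φ : Cochain k C n) (x : Fin (n + 2) → C)
    (f : ∀ i : Fin (n + 1), (x i.succ ⟶ x i.castSucc)) :
    dMiddle j φ x f ≍ φ (mergeObj x j) (mergeHom x f j) := by
  change eqToHom _ ≫ φ (mergeObj x j) (mergeHom x f j) ≫ eqToHom _ ≍ _
  rw [eqToHom_comp_heq_iff]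
  exact comp_eqToHom_heq _ _

/-- `dLeft` as a linear map. -/
def dLeftₗ (n : ℕ) : Cochain k C n →ₗ[k] Cochain k C (n + 1) where
  toFun := dLeft
  map_add' _ _ := Cochain.ext fun _ _ => Preadditive.add_comp _ _ _ _ _ _
  map_smul' _ _ := Cochain.ext fun _ _ => Linear.smul_comp _ _ _ _ _ _

/-- `dRight` as a linear map. -/
def dRightₗ (n : ℕ) : Cochain k C n →ₗ[k] Cochain k C (n + 1) where
  toFun := dRight
  map_add' _ _ := Cochain.ext fun _ _ => Preadditive.comp_add _ _ _ _ _ _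
  map_smul' _ _ := Cochain.ext fun _ _ => Linear.comp_smul _ _ _ _ _ _

/-- `dMiddle` as a linear map. -/
def dMiddleₗ {n : ℕ} (j : Fin n) : Cochain k C n →ₗ[k] Cochain k C (n + 1) where
  toFun := dMiddle j
  map_add' _ _ := Cochain.ext fun x _ =>
    (sandwich k (eqToHom (mergeObj_gt x j (Fin.last n) j.2).symm)
      (eqToHom (mergeObj_lt x j 0 (Nat.zero_le _)))).map_add _ _
  map_smul' _ _ := Cochain.ext fun x _ =>
    (sandwich k (eqToHom (mergeObj_gt x j (Fin.last n) j.2).symm)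
      (eqToHom (mergeObj_lt x j 0 (Nat.zero_le _)))).map_smul _ _

theorem dLeftₗ_apply {n : ℕ} (φ : Cochain k C n) : dLeftₗ n φ = dLeft φ := rfl

theorem dRightₗ_apply {n : ℕ} (φ : Cochain k C n) : dRightₗ n φ = dRight φ := rfl

theorem dMiddleₗ_apply {n : ℕ} (j : Fin n) (φ : Cochain k C n) : dMiddleₗ j φ = dMiddle j φ := rfl

variable (k C) in
/-- The Hochschild coboundary. On `f₀, …, fₙ` it is
`(-1)ⁿ⁺¹ f₀ ∘ φ(f₁, …, fₙ) + ∑ⱼ (-1)ⁿ⁻ʲ φ(f₀, …, fⱼ ∘ fⱼ₊₁, …, fₙ) + φ(f₀, …, fₙ₋₁) ∘ fₙ`. -/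
def d (n : ℕ) : Cochain k C n →ₗ[k] Cochain k C (n + 1) :=
  (-1 : k) ^ (n + 1) • dLeftₗ n + ∑ j : Fin n, (-1 : k) ^ (n - j.1) • dMiddleₗ j + dRightₗ n

theorem d_eq {n : ℕ} (φ : Cochain k C n) :
    d k C n φ = (-1 : k) ^ (n + 1) • dLeft φ +
      ∑ j : Fin n, (-1 : k) ^ (n - j.1) • dMiddle j φ + dRight φ := by
  simp only [d, LinearMap.add_apply, LinearMap.smul_apply, LinearMap.sum_apply, dLeftₗ_apply,
    dMiddleₗ_apply, dRightₗ_apply]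

theorem d_apply {n : ℕ} (φ : Cochain k C n) (x : Fin (n + 2) → C)
    (f : ∀ i : Fin (n + 1), (x i.succ ⟶ x i.castSucc)) :
    d k C n φ x f = (-1 : k) ^ (n + 1) • dLeft φ x f +
      ∑ j : Fin n, (-1 : k) ^ (n - j.1) • dMiddle j φ x f + dRight φ x f := by
  simp only [d_eq, Cochain.add_apply, Cochain.smul_apply, Cochain.sum_apply]

theorem dLeft_dLeft {n : ℕ} (φ : Cochain k C n) : dMiddle 0 (dLeft φ) = dLeft (dLeft φ) := by
  refine Cochain.ext fun x f => eq_of_heq ((dMiddle_heq _ _ _ _).trans ?_)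
  rw [dLeft_apply, dLeft_apply]
  refine HEq.trans ?_ (heq_of_eq (Category.assoc _ _ _).symm)
  refine comp_heq ?_ ?_ ?_ ?_ (mergeHom_eq _ _ _ _ rfl)
  · exact mergeObj_gt _ _ _ (by simp)
  · exact mergeObj_gt _ _ _ (by simp)
  · exact mergeObj_lt _ _ _ (by simp)
  · exact cochain_heq φ (fun i => mergeObj_gt _ _ _ (by simp))
      fun i => mergeHom_gt _ _ _ _ (by simp)

theorem dMiddle_dLeft {n : ℕ} (j : Fin n) (φ : Cochain k C n) :
    dMiddle j.succ (dLeft φ) = dLeft (dMiddle j φ) := by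
  refine Cochain.ext fun x f => eq_of_heq ((dMiddle_heq _ _ _ _).trans ?_)
  rw [dLeft_apply, dLeft_apply]
  refine comp_heq ?_ ?_ ?_ (HEq.trans ?_ (dMiddle_heq _ _ _ _).symm) (mergeHom_lt _ _ _ _ (by simp))
  · exact mergeObj_gt _ _ _ (by simp)
  · exact mergeObj_lt _ _ _ (by simp)
  · exact mergeObj_lt _ _ _ (by simp)
  · refine cochain_heq φ (fun i => ?_) (fun i => ?_)
    · rcases le_or_gt i.1 j.1 with h | h
      · exact (mergeObj_lt _ _ _ (by simpa using h)).trans (mergeObj_lt (fun i => x i.succ) _ _ h).symm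
      · exact (mergeObj_gt _ _ _ (by simpa using h)).trans (mergeObj_gt (fun i => x i.succ) _ _ h).symm
    · rcases lt_trichotomy i.1 j.1 with h | h | h
      · refine HEq.trans (mergeHom_lt _ _ _ _ (by simpa using h)) (HEq.symm ?_)
        exact HEq.trans (mergeHom_lt _ _ _ _ h) HEq.rfl
      · refine HEq.trans (mergeHom_eq _ _ _ _ (by simpa using h)) (HEq.symm ?_)
        exact HEq.trans (mergeHom_eq _ _ _ _ h) HEq.rfl
      · refine HEq.trans (mergeHom_gt _ _ _ _ (by simpa using h)) (HEq.symm ?_)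
        exact HEq.trans (mergeHom_gt _ _ _ _ h) HEq.rfl

theorem dRight_dLeft {n : ℕ} (φ : Cochain k C n) : dRight (dLeft φ) = dLeft (dRight φ) := by
  refine Cochain.ext fun x f => ?_
  rw [dLeft_apply, dRight_apply]
  exact (Category.assoc _ _ _).symm

theorem dMiddle_dRight {n : ℕ} (j : Fin n) (φ : Cochain k C n) :
    dMiddle j.castSucc (dRight φ) = dRight (dMiddle j φ) := by
  refine Cochain.ext fun x f => eq_of_heq ((dMiddle_heq _ _ _ _).trans ?_)
  rw [dRight_apply, dRight_apply]
  refine comp_heq ?_ ?_ ?_ (mergeHom_gt _ _ _ _ (by simp)) (HEq.trans ?_ (dMiddle_heq _ _ _ _).symm)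
  · exact mergeObj_gt _ _ _ (by simp)
  · exact mergeObj_gt _ _ _ (by simp)
  · exact mergeObj_lt _ _ _ (by simp)
  · refine cochain_heq φ (fun i => ?_) (fun i => ?_)
    · rcases le_or_gt i.1 j.1 with h | h
      · exact (mergeObj_lt _ _ _ (by simpa using h)).trans (mergeObj_lt (fun i => x i.castSucc) _ _ h).symm
      · exact (mergeObj_gt _ _ _ (by simpa using h)).trans (mergeObj_gt (fun i => x i.castSucc) _ _ h).symm
    · rcases lt_trichotomy i.1 j.1 with h | h | h
      · refine HEq.trans (mergeHom_lt _ _ _ _ (by simpa using h)) (HEq.symm ?_)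
        exact HEq.trans (mergeHom_lt _ _ _ _ h) HEq.rfl
      · refine HEq.trans (mergeHom_eq _ _ _ _ (by simpa using h)) (HEq.symm ?_)
        exact HEq.trans (mergeHom_eq _ _ _ _ h) HEq.rfl
      · refine HEq.trans (mergeHom_gt _ _ _ _ (by simpa using h)) (HEq.symm ?_)
        exact HEq.trans (mergeHom_gt _ _ _ _ h) HEq.rfl

theorem dRight_dRight {n : ℕ} (φ : Cochain k C n) :
    dMiddle (Fin.last n) (dRight φ) = dRight (dRight φ) := by
  refine Cochain.ext fun x f => eq_of_heq ((dMiddle_heq _ _ _ _).trans ?_)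
  rw [dRight_apply, dRight_apply]
  refine HEq.trans ?_ (heq_of_eq (Category.assoc _ _ _))
  refine comp_heq ?_ ?_ ?_ (mergeHom_eq _ _ _ _ rfl) ?_
  · exact mergeObj_gt _ _ _ (by simp)
  · exact mergeObj_lt _ _ _ (by simp)
  · exact mergeObj_lt _ _ _ (by simp)
  · exact cochain_heq φ (fun i => mergeObj_lt _ _ _ (by simp; omega))
      fun i => mergeHom_lt _ _ _ _ (by simp)

theorem mergeObj_mergeObj {n : ℕ} (x : Fin (n + 3) → C) (i j : Fin n) (h : i ≤ j)
    (a : Fin (n + 1)) : mergeObj (mergeObj x i.castSucc) j a = mergeObj (mergeObj x j.succ) i a := by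
  have h := Fin.le_def.1 h
  rcases le_or_gt a.1 i.1 with h1 | h1
  · rw [mergeObj_lt _ j _ (by omega), mergeObj_lt _ i _ h1, mergeObj_lt _ _ _ (by simpa using h1),
      mergeObj_lt _ _ _ (by simp; omega)]
  · rcases le_or_gt a.1 j.1 with h2 | h2
    · rw [mergeObj_lt _ j _ h2, mergeObj_gt _ i _ h1, mergeObj_gt _ _ _ (by simpa using h1),
        mergeObj_lt _ _ _ (by simpa using h2)]
      rfl
    · rw [mergeObj_gt _ j _ h2, mergeObj_gt _ i _ h1, mergeObj_gt _ _ _ (by simp; omega),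
        mergeObj_gt _ _ _ (by simpa using h2)]

theorem mergeHom_mergeHom {n : ℕ} (x : Fin (n + 3) → C)
    (f : ∀ i : Fin (n + 2), (x i.succ ⟶ x i.castSucc)) (i j : Fin n) (h : i ≤ j) (a : Fin n) :
    mergeHom (mergeObj x i.castSucc) (mergeHom x f i.castSucc) j a ≍
      mergeHom (mergeObj x j.succ) (mergeHom x f j.succ) i a := by
  have h := Fin.le_def.1 h
  rcases lt_trichotomy a.1 i.1 with h1 | h1 | h1
  · refine (mergeHom_lt _ _ _ _ (by omega)).trans (HEq.trans ?_ (mergeHom_lt _ _ _ _ h1).symm)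
    exact (mergeHom_lt _ _ _ _ (by simpa using h1)).trans (mergeHom_lt _ _ _ _ (by simp; omega)).symm
  · refine HEq.trans ?_ (mergeHom_eq _ _ _ _ h1).symm
    rcases lt_or_eq_of_le h with h2 | h2
    · refine (mergeHom_lt _ _ _ _ (by omega)).trans ((mergeHom_eq _ _ _ _ (by simpa using h1)).trans ?_)
      refine comp_heq ?_ ?_ ?_ (mergeHom_lt x f j.succ a.succ ?_).symm
        (mergeHom_lt x f j.succ a.castSucc ?_).symm
      · exact (mergeObj_lt x j.succ a.succ.succ (by simp; omega)).symm
      · exact (mergeObj_lt x j.succ a.succ.castSucc (by simp; omega)).symm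
      · exact (mergeObj_lt x j.succ a.castSucc.castSucc (by simp; omega)).symm
      · simp; omega
      · simp; omega
    · refine (mergeHom_eq _ _ _ _ (by omega)).trans ?_
      refine (comp_heq (f' := f a.succ.succ) (h' := f a.castSucc.succ ≫ f a.castSucc.castSucc)
        ?_ ?_ ?_ (mergeHom_gt x f i.castSucc a.succ ?_)
        (mergeHom_eq x f i.castSucc a.castSucc ?_)).trans ?_
      · exact mergeObj_gt _ _ _ (by simp; omega)
      · exact mergeObj_gt _ _ _ (by simp; omega)
      · exact mergeObj_lt _ _ _ (by simp; omega)
      · simp; omega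
      · simp; omega
      · refine HEq.trans (heq_of_eq (Category.assoc _ _ _).symm) ?_
        refine comp_heq ?_ ?_ ?_ (mergeHom_eq x f j.succ a.succ ?_).symm
          (mergeHom_lt x f j.succ a.castSucc ?_).symm
        · exact (mergeObj_gt _ _ _ (by simp; omega)).symm
        · exact (mergeObj_lt _ _ _ (by simp; omega)).symm
        · exact (mergeObj_lt _ _ _ (by simp; omega)).symm
        · simp; omega
        · simp; omega
  · refine HEq.trans ?_ (mergeHom_gt _ _ _ _ h1).symm
    rcases lt_trichotomy a.1 j.1 with h2 | h2 | h2
    · refine (mergeHom_lt _ _ _ _ h2).trans ?_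
      exact (mergeHom_gt _ _ _ _ (by simpa using h1)).trans
        (mergeHom_lt x f j.succ a.succ (by simpa using h2)).symm
    · refine (mergeHom_eq _ _ _ _ h2).trans (HEq.trans ?_ (mergeHom_eq _ _ _ _ (by simpa using h2)).symm)
      refine comp_heq ?_ ?_ ?_ (mergeHom_gt _ _ _ _ ?_) (mergeHom_gt _ _ _ _ ?_)
      · exact mergeObj_gt _ _ _ (by simp; omega)
      · exact mergeObj_gt _ _ _ (by simp; omega)
      · exact mergeObj_gt _ _ _ (by simp; omega)
      · simp; omega
      · simp; omega
    · refine (mergeHom_gt _ _ _ _ h2).trans ?_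
      exact (mergeHom_gt _ _ _ _ (by simp; omega)).trans
        (mergeHom_gt _ _ _ _ (by simpa using h2)).symm

theorem dMiddle_dMiddle {n : ℕ} (i j : Fin n) (h : i ≤ j) (φ : Cochain k C n) :
    dMiddle i.castSucc (dMiddle j φ) = dMiddle j.succ (dMiddle i φ) := by
  refine Cochain.ext fun x f => eq_of_heq ((dMiddle_heq _ _ _ _).trans
    (HEq.trans ?_ (dMiddle_heq _ _ _ _).symm))
  refine (dMiddle_heq _ _ _ _).trans (HEq.trans ?_ (dMiddle_heq _ _ _ _).symm)
  exact cochain_heq φ (mergeObj_mergeObj x i j h) (mergeHom_mergeHom x f i j h)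

theorem sum_dMiddle_dMiddle {n : ℕ} (φ : Cochain k C n) :
    ∑ i : Fin (n + 1), ∑ j : Fin n,
      (-1 : k) ^ ((n + 1 - i.1) + (n - j.1)) • dMiddle i (dMiddle j φ) = 0 := by
  rw [← Fintype.sum_prod_type']
  refine Finset.sum_involution (fun p _ => if h : p.1.1 ≤ p.2.1 then
      (p.2.succ, ⟨p.1.1, by omega⟩) else (p.2.castSucc, ⟨p.1.1 - 1, by omega⟩)) ?_ ?_ ?_ ?_
  · rintro ⟨i, j⟩ -
    have hj := j.2
    split_ifs with h
    · replace h : i.1 ≤ j.1 := h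
      have e : dMiddle i (dMiddle j φ) = dMiddle j.succ (dMiddle ⟨i.1, by omega⟩ φ) :=
        dMiddle_dMiddle ⟨i.1, by omega⟩ j (Fin.le_def.2 h) φ
      simp only [e, Fin.val_succ]
      rw [show n + 1 - i.1 + (n - j.1) = (n + 1 - (j.1 + 1) + (n - i.1)) + 1 by omega, pow_succ]
      simp
    · replace h : ¬ i.1 ≤ j.1 := h
      have e : dMiddle j.castSucc (dMiddle ⟨i.1 - 1, by omega⟩ φ) = dMiddle i (dMiddle j φ) := by
        have := dMiddle_dMiddle j ⟨i.1 - 1, by omega⟩ (Fin.le_def.2 (by simp; omega)) φ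
        rw [this]
        congr 1
        ext; simp; omega
      simp only [e, Fin.val_castSucc]
      rw [show n + 1 - j.1 + (n - (i.1 - 1)) = (n + 1 - i.1 + (n - j.1)) + 1 by omega, pow_succ]
      simp
  · rintro ⟨i, j⟩ - - h
    have := congrArg (fun p : Fin (n + 1) × Fin n => p.1.1) h
    split_ifs at this with h'
    · simp at this h'; omega
    · simp at this h'; omega
  · intros; simp
  · rintro ⟨i, j⟩ -
    by_cases h : i.1 ≤ j.1
    · simp [h]
    · have h' : j.1 ≤ i.1 - 1 := by omega
      simp [h, h', Prod.ext_iff, Fin.ext_iff]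
      omega

/-- The Hochschild-Mitchell cochains form a complex. -/
theorem d_d {n : ℕ} (φ : Cochain k C n) : d k C (n + 1) (d k C n φ) = 0 := by
  have hL : dLeft (d k C n φ) = (-1 : k) ^ (n + 1) • dLeft (dLeft φ) +
      ∑ j : Fin n, (-1 : k) ^ (n - j.1) • dLeft (dMiddle j φ) + dLeft (dRight φ) := by
    rw [d_eq]
    simp only [← dLeftₗ_apply, map_add, map_sum, map_smul]
  have hR : dRight (d k C n φ) = (-1 : k) ^ (n + 1) • dRight (dLeft φ) +
      ∑ j : Fin n, (-1 : k) ^ (n - j.1) • dRight (dMiddle j φ) + dRight (dRight φ) := by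
    rw [d_eq]
    simp only [← dRightₗ_apply, map_add, map_sum, map_smul]
  have hM : ∀ i, dMiddle i (d k C n φ) = (-1 : k) ^ (n + 1) • dMiddle i (dLeft φ) +
      ∑ j : Fin n, (-1 : k) ^ (n - j.1) • dMiddle i (dMiddle j φ) + dMiddle i (dRight φ) := by
    intro i
    rw [d_eq]
    simp only [← dMiddleₗ_apply, map_add, map_sum, map_smul]
  rw [d_eq (d k C n φ), hL, hR]
  simp only [hM, smul_add, Finset.sum_add_distrib, Finset.smul_sum, smul_smul, ← pow_add]
  rw [sum_dMiddle_dMiddle, Fin.sum_univ_succ, Fin.sum_univ_castSucc (n := n)]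
  simp only [dLeft_dLeft, dMiddle_dLeft, dRight_dLeft, dMiddle_dRight, dRight_dRight]
  have e1 : ∀ j : Fin n, (-1 : k) ^ (n + 1 - j.succ.1 + (n + 1)) =
      - (-1 : k) ^ (n + 1 + 1 + (n - j.1)) := by
    intro j
    have hj := j.2
    rw [Fin.val_succ, show n + 1 + 1 + (n - j.1) = (n + 1 - (j.1 + 1) + (n + 1)) + 1 by omega,
      pow_succ]
    simp
  have e2 : ∀ j : Fin n, (-1 : k) ^ (n + 1 - j.castSucc.1) = - (-1 : k) ^ (n - j.1) := by
    intro j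
    have hj := j.2
    rw [Fin.val_castSucc, show n + 1 - j.1 = (n - j.1) + 1 by omega, pow_succ]
    simp
  have e3 : (-1 : k) ^ (n + 1 + 1 + (n + 1)) = -1 :=
    Odd.neg_one_pow ⟨n + 1, by omega⟩
  have e4 : (-1 : k) ^ (n + 1 - (0 : Fin (n + 1)).1 + (n + 1)) = 1 :=
    Even.neg_one_pow ⟨n + 1, by simp⟩
  have e5 : (-1 : k) ^ (n + 1 - (Fin.last n).1) = -1 := by simp
  simp only [e1, e2, e3, e4, e5, neg_smul, Finset.sum_neg_distrib, one_smul, pow_succ, mul_neg,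
    mul_one, neg_neg]
  abel

/-- The cup product `(ψ ⌣ φ)(f₀, …, fₘ₊ₙ₋₁) = ψ(f₀, …, fₘ₋₁) ∘ φ(fₘ, …, fₘ₊ₙ₋₁)`. -/
def cup {m n : ℕ} (ψ : Cochain k C m) (φ : Cochain k C n) : Cochain k C (m + n) := fun x =>
  mkMulti (fun f => (φ (fun i => x (Fin.natAdd m i)) (fun i => f (Fin.natAdd m i)) ≫
    ψ (fun i => x ⟨i, by omega⟩) (fun i => f (Fin.castAdd n i)) :
      x (Fin.last (m + n)) ⟶ x 0)) (by
    intro f i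
    refine Fin.addCases (fun i => ?_) (fun i => ?_) i
    · refine ⟨(Linear.leftComp k (x 0) (φ (fun i => x (Fin.natAdd m i))
        (fun i => f (Fin.natAdd m i)))).comp
        ((ψ (fun i => x ⟨i, by omega⟩)).toLinearMap (fun i => f (Fin.castAdd n i)) i),
        fun c => ?_⟩
      have h1 : (fun j : Fin m => Function.update f (Fin.castAdd n i) c (Fin.castAdd n j)) =
          Function.update (fun j : Fin m => f (Fin.castAdd n j)) i c := by
        funext j
        by_cases h : j = i
        · subst h; simp
        · rw [Function.update_of_ne h, Function.update_of_ne (by simpa using h)]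
      have h2 : (fun j : Fin n => Function.update f (Fin.castAdd n i) c (Fin.natAdd m j)) =
          (fun j : Fin n => f (Fin.natAdd m j)) := by
        funext j
        rw [Function.update_of_ne]
        simp only [ne_eq, Fin.ext_iff, Fin.val_natAdd, Fin.val_castAdd]; omega
      simp only [h2]
      exact congrArg (fun z => φ (fun i => x (Fin.natAdd m i)) (fun i => f (Fin.natAdd m i)) ≫
        ψ (fun i => x ⟨i, by omega⟩) z) h1
    · refine ⟨(Linear.rightComp k (x (Fin.last (m + n))) (ψ (fun i => x ⟨i, by omega⟩)
        (fun i => f (Fin.castAdd n i)))).comp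
        ((φ (fun i => x (Fin.natAdd m i))).toLinearMap (fun i => f (Fin.natAdd m i)) i),
        fun c => ?_⟩
      have h1 : (fun j : Fin n => Function.update f (Fin.natAdd m i) c (Fin.natAdd m j)) =
          Function.update (fun j : Fin n => f (Fin.natAdd m j)) i c := by
        funext j
        by_cases h : j = i
        · subst h; simp
        · rw [Function.update_of_ne h, Function.update_of_ne (by simpa using h)]
      have h2 : (fun j : Fin m => Function.update f (Fin.natAdd m i) c (Fin.castAdd n j)) =
          (fun j : Fin m => f (Fin.castAdd n j)) := by
        funext j
        rw [Function.update_of_ne]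
        simp only [ne_eq, Fin.ext_iff, Fin.val_natAdd, Fin.val_castAdd]; omega
      simp only [h2]
      exact congrArg (fun z => φ (fun i => x (Fin.natAdd m i)) z ≫
        ψ (fun i => x ⟨i, by omega⟩) (fun i => f (Fin.castAdd n i))) h1)

theorem cup_apply {m n : ℕ} (ψ : Cochain k C m) (φ : Cochain k C n) (x : Fin (m + n + 1) → C)
    (f : ∀ i : Fin (m + n), (x i.succ ⟶ x i.castSucc)) :
    cup ψ φ x f = φ (fun i => x (Fin.natAdd m i)) (fun i => f (Fin.natAdd m i)) ≫
    ψ (fun i => x ⟨i, by omega⟩) (fun i => f (Fin.castAdd n i)) := rfl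

variable (k C) in
/-- The unit of the cup product: the family of identity morphisms. -/
def cupOne : Cochain k C 0 := fun x => MultilinearMap.constOfIsEmpty k _ (𝟙 (x 0))


variable (k C) in
/-- The cup product as a bilinear map. -/
def cupₗ (m n : ℕ) : Cochain k C m →ₗ[k] Cochain k C n →ₗ[k] Cochain k C (m + n) :=
  LinearMap.mk₂ k cup
    (fun _ _ _ => by refine Cochain.ext fun x f => ?_; exact Preadditive.comp_add _ _ _ _ _ _)
    (fun _ _ _ => by refine Cochain.ext fun x f => ?_; exact Linear.comp_smul _ _ _ _ _ _)
    (fun _ _ _ => by refine Cochain.ext fun x f => ?_; exact Preadditive.add_comp _ _ _ _ _ _)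
    (fun _ _ _ => by refine Cochain.ext fun x f => ?_; exact Linear.smul_comp _ _ _ _ _ _)

theorem cupₗ_apply {m n : ℕ} (ψ : Cochain k C m) (φ : Cochain k C n) :
    cupₗ k C m n ψ φ = cup ψ φ := rfl

theorem cochain_ext_heq {n n' : ℕ} (h : n = n') {φ : Cochain k C n} {φ' : Cochain k C n'}
    (H : ∀ (x : Fin (n + 1) → C) (f : ∀ i : Fin n, (x i.succ ⟶ x i.castSucc)),
      φ x f ≍ φ' (fun i => x ⟨i, by omega⟩) (fun i => f ⟨i, by omega⟩)) : φ ≍ φ' := by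
  subst h
  apply heq_of_eq
  refine Cochain.ext fun x f => ?_
  exact eq_of_heq (H x f)

variable (k C) in
/-- Transport of cochains along an equality of degrees. -/
def castₗ {n n' : ℕ} (h : n = n') : Cochain k C n →ₗ[k] Cochain k C n' :=
  h ▸ LinearMap.id

theorem castₗ_heq {n n' : ℕ} (h : n = n') (φ : Cochain k C n) : castₗ k C h φ ≍ φ := by
  subst h; rfl

theorem castₗ_eq {n n' : ℕ} (h : n = n') {φ : Cochain k C n} {φ' : Cochain k C n'}
    (H : φ ≍ φ') : castₗ k C h φ = φ' := by
  subst h; exact eq_of_heq H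

theorem dLeft_cup {m n : ℕ} (ψ : Cochain k C m) (φ : Cochain k C n) :
    castₗ k C (by omega : m + 1 + n = m + n + 1) (cup (dLeft ψ) φ) = dLeft (cup ψ φ) := by
  refine castₗ_eq _ (cochain_ext_heq (by omega) fun x f => ?_)
  rw [cup_apply, dLeft_apply, dLeft_apply, cup_apply]
  refine HEq.trans (heq_of_eq (Category.assoc _ _ _).symm) ?_
  refine comp_heq (congrArg x (Fin.ext (by simp; omega))) rfl rfl ?_ HEq.rfl
  refine comp_heq (congrArg x (Fin.ext (by simp; omega))) (congrArg x (Fin.ext (by simp))) rfl ?_ ?_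
  · exact cochain_heq φ (fun i => congrArg x (Fin.ext (by simp; omega)))
      fun i => arrow_heq f (by simp; omega)
  · exact HEq.rfl

theorem cup_dRight {m n : ℕ} (ψ : Cochain k C m) (φ : Cochain k C n) :
    dRight (cup ψ φ) = cup ψ (dRight φ) := by
  refine Cochain.ext fun x f => ?_
  rw [cup_apply, dRight_apply, dRight_apply, cup_apply]
  exact (Category.assoc _ _ _).symm

theorem dRight_cup {m n : ℕ} (ψ : Cochain k C m) (φ : Cochain k C n) :
    castₗ k C (by omega : m + 1 + n = m + n + 1) (cup (dRight ψ) φ) = cup ψ (dLeft φ) := by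
  refine castₗ_eq _ (cochain_ext_heq (by omega) fun x f => ?_)
  rw [cup_apply, dRight_apply, cup_apply, dLeft_apply]
  refine HEq.trans ?_ (heq_of_eq (Category.assoc _ _ _).symm)
  refine comp_heq (congrArg x (Fin.ext (by simp; omega))) (congrArg x (Fin.ext (by simp))) rfl ?_ ?_
  · exact cochain_heq φ (fun i => congrArg x (Fin.ext (by simp; omega)))
      fun i => arrow_heq f (by simp; omega)
  · exact HEq.rfl

theorem dMiddle_cup {m n : ℕ} (j : Fin m) (ψ : Cochain k C m) (φ : Cochain k C n) :
    castₗ k C (by omega : m + 1 + n = m + n + 1) (cup (dMiddle j ψ) φ) =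
      dMiddle (Fin.castAdd n j) (cup ψ φ) := by
  refine castₗ_eq _ (cochain_ext_heq (by omega) fun x f => ?_)
  refine HEq.trans ?_ (dMiddle_heq _ _ _ _).symm
  rw [cup_apply, cup_apply]
  have hj := j.2
  refine comp_heq ?_ ?_ ?_ ?_ ((dMiddle_heq _ _ _ _).trans ?_)
  · rw [mergeObj_gt _ _ _ (by simp; omega)]
    exact congrArg x (Fin.ext (by simp; omega))
  · rw [mergeObj_gt _ _ _ (by simp)]
    exact congrArg x (Fin.ext (by simp))
  · rw [mergeObj_lt _ _ _ (by simp)]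
    exact congrArg x (Fin.ext (by simp))
  · refine cochain_heq φ (fun i => ?_) (fun i => ?_)
    · rw [mergeObj_gt _ _ _ (by simp; omega)]
      exact congrArg x (Fin.ext (by simp; omega))
    · refine HEq.trans ?_ (mergeHom_gt _ _ _ _ (by simp; omega)).symm
      exact arrow_heq f (by simp; omega)
  · refine cochain_heq ψ (fun i => ?_) (fun i => ?_)
    · rcases le_or_gt i.1 j.1 with h | h
      · rw [mergeObj_lt _ _ _ h, mergeObj_lt _ _ _ (by simpa using h)]
        rfl
      · rw [mergeObj_gt _ _ _ h, mergeObj_gt _ _ _ (by simpa using h)]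
        rfl
    · rcases lt_trichotomy i.1 j.1 with h | h | h
      · refine HEq.trans (mergeHom_lt _ _ _ _ h) (HEq.symm ?_)
        exact HEq.trans (mergeHom_lt _ _ _ _ (by simpa using h)) HEq.rfl
      · refine HEq.trans (mergeHom_eq _ _ _ _ h) (HEq.symm ?_)
        exact HEq.trans (mergeHom_eq _ _ _ _ (by simpa using h)) HEq.rfl
      · refine HEq.trans (mergeHom_gt _ _ _ _ h) (HEq.symm ?_)
        exact HEq.trans (mergeHom_gt _ _ _ _ (by simpa using h)) HEq.rfl

theorem cup_dMiddle {m n : ℕ} (j : Fin n) (ψ : Cochain k C m) (φ : Cochain k C n) :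
    dMiddle (Fin.natAdd m j) (cup ψ φ) = cup ψ (dMiddle j φ) := by
  refine Cochain.ext fun x f => ?_
  refine eq_of_heq ((dMiddle_heq _ _ _ _).trans ?_)
  rw [cup_apply, cup_apply]
  have hj := j.2
  refine comp_heq ?_ ?_ ?_ (HEq.trans ?_ (dMiddle_heq _ _ _ _).symm) ?_
  · rw [mergeObj_gt _ _ _ (by simp)]
    exact congrArg x (Fin.ext (by simp; omega))
  · rw [mergeObj_lt _ _ _ (by simp)]
    exact congrArg x (Fin.ext (by simp))
  · rw [mergeObj_lt _ _ _ (by simp)]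
    exact congrArg x (Fin.ext (by simp))
  · refine cochain_heq φ (fun i => ?_) (fun i => ?_)
    · rcases le_or_gt i.1 j.1 with h | h
      · rw [mergeObj_lt _ _ _ (by simpa using h), mergeObj_lt _ _ _ h]
        rfl
      · rw [mergeObj_gt _ _ _ (by simpa using h), mergeObj_gt _ _ _ h]
        rfl
    · rcases lt_trichotomy i.1 j.1 with h | h | h
      · refine HEq.trans (mergeHom_lt _ _ _ _ (by simpa using h)) (HEq.symm ?_)
        exact HEq.trans (mergeHom_lt _ _ _ _ h) HEq.rfl
      · refine HEq.trans (mergeHom_eq _ _ _ _ (by simpa using h)) (HEq.symm ?_)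
        exact HEq.trans (mergeHom_eq _ _ _ _ h) HEq.rfl
      · refine HEq.trans (mergeHom_gt _ _ _ _ (by simpa using h)) (HEq.symm ?_)
        exact HEq.trans (mergeHom_gt _ _ _ _ h) HEq.rfl
  · refine cochain_heq ψ (fun i => ?_) (fun i => ?_)
    · rw [mergeObj_lt _ _ _ (by simp; omega)]
      exact congrArg x (Fin.ext (by simp))
    · refine (mergeHom_lt _ _ _ _ (by simp; omega)).trans ?_
      exact arrow_heq f (by simp)

/-- The graded Leibniz rule. -/
theorem d_cup {m n : ℕ} (ψ : Cochain k C m) (φ : Cochain k C n) :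
    d k C (m + n) (cup ψ φ) = cup ψ (d k C n φ) +
      (-1 : k) ^ n • castₗ k C (by omega : m + 1 + n = m + n + 1) (cup (d k C m ψ) φ) := by
  have e1 : cup ψ (d k C n φ) = (-1 : k) ^ (n + 1) • cup ψ (dLeft φ) +
      ∑ j : Fin n, (-1 : k) ^ (n - j.1) • cup ψ (dMiddle j φ) + cup ψ (dRight φ) := by
    simp only [← cupₗ_apply, d_eq, map_add, map_sum, map_smul]
  have e2 : cup (d k C m ψ) φ = (-1 : k) ^ (m + 1) • cup (dLeft ψ) φ +
      ∑ j : Fin m, (-1 : k) ^ (m - j.1) • cup (dMiddle j ψ) φ + cup (dRight ψ) φ := by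
    simp only [← cupₗ_apply, d_eq, map_add, map_sum, map_smul, LinearMap.add_apply,
      LinearMap.sum_apply, LinearMap.smul_apply]
  rw [e1, e2, d_eq, Fin.sum_univ_add]
  simp only [map_add, map_sum, map_smul, dLeft_cup, dRight_cup, dMiddle_cup, cup_dMiddle,
    cup_dRight, smul_add, Finset.smul_sum, smul_smul, ← pow_add]
  have s1 : ∀ j : Fin m, m + n - (Fin.castAdd n j).1 = n + (m - j.1) := by
    intro j; simp; omega
  have s2 : ∀ j : Fin n, m + n - (Fin.natAdd m j).1 = n - j.1 := by
    intro j; simp; omega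
  simp only [s1, s2, show n + (m + 1) = m + n + 1 by omega, pow_succ, mul_neg, mul_one, neg_smul]
  abel

variable (k C) in
/-- The cocycles of degree `n`. -/
def cocycles (n : ℕ) : Submodule k (Cochain k C n) := LinearMap.ker (d k C n)

variable (k C) in
/-- The coboundaries of degree `n`. -/
def coboundaries : ∀ n : ℕ, Submodule k (Cochain k C n)
  | 0 => ⊥
  | n + 1 => LinearMap.range (d k C n)

variable (k C) in
/-- Hochschild-Mitchell cohomology in degree `n`: cocycles modulo coboundaries. -/
def HHn (n : ℕ) : Type (max u v) :=
  cocycles k C n ⧸ (coboundaries k C n).submoduleOf (cocycles k C n)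

instance (n : ℕ) : AddCommGroup (HHn k C n) :=
  inferInstanceAs (AddCommGroup (_ ⧸ (coboundaries k C n).submoduleOf (cocycles k C n)))

instance (n : ℕ) : Module k (HHn k C n) :=
  inferInstanceAs (Module k (_ ⧸ (coboundaries k C n).submoduleOf (cocycles k C n)))

/-- The class of a cocycle. -/
def HHn.mk {n : ℕ} : cocycles k C n →ₗ[k] HHn k C n :=
  ((coboundaries k C n).submoduleOf (cocycles k C n)).mkQ

theorem HHn.mk_surjective {n : ℕ} : Function.Surjective (HHn.mk (k := k) (C := C) (n := n)) :=
  Submodule.mkQ_surjective _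

theorem HHn.mk_eq_zero {n : ℕ} (z : cocycles k C n) (h : (z : Cochain k C n) ∈ coboundaries k C n) :
    HHn.mk z = 0 :=
  (Submodule.Quotient.mk_eq_zero _).2 h

theorem castₗ_mem_coboundaries {n n' : ℕ} (h : n = n') {φ : Cochain k C n} :
    castₗ k C h φ ∈ coboundaries k C n' ↔ φ ∈ coboundaries k C n := by
  subst h; rfl

theorem cup_zero {m n : ℕ} (ψ : Cochain k C m) : cup ψ (0 : Cochain k C n) = 0 :=
  (cupₗ k C m n ψ).map_zero

theorem zero_cup {m n : ℕ} (φ : Cochain k C n) : cup (0 : Cochain k C m) φ = 0 :=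
  (cupₗ k C m n).map_zero₂ φ

theorem cup_mem_cocycles {m n : ℕ} {ψ : Cochain k C m} {φ : Cochain k C n}
    (hψ : ψ ∈ cocycles k C m) (hφ : φ ∈ cocycles k C n) : cup ψ φ ∈ cocycles k C (m + n) := by
  have h1 : d k C m ψ = 0 := hψ
  have h2 : d k C n φ = 0 := hφ
  change d k C (m + n) (cup ψ φ) = 0
  rw [d_cup, h1, h2, cup_zero, zero_cup, map_zero, smul_zero, add_zero]

theorem cup_mem_coboundaries_right {m n : ℕ} {ψ : Cochain k C m} {φ : Cochain k C n}
    (hψ : ψ ∈ cocycles k C m) (hφ : φ ∈ coboundaries k C n) :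
    cup ψ φ ∈ coboundaries k C (m + n) := by
  have h1 : d k C m ψ = 0 := hψ
  cases n with
  | zero =>
    obtain rfl : φ = 0 := hφ
    rw [cup_zero]; exact zero_mem _
  | succ n =>
    obtain ⟨η, rfl⟩ := hφ
    refine ⟨cup ψ η, ?_⟩
    change d k C (m + n) (cup ψ η) = _
    rw [d_cup, h1, zero_cup, map_zero, smul_zero, add_zero]

theorem cup_mem_coboundaries_left {m n : ℕ} {ψ : Cochain k C m} {φ : Cochain k C n}
    (hψ : ψ ∈ coboundaries k C m) (hφ : φ ∈ cocycles k C n) :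
    cup ψ φ ∈ coboundaries k C (m + n) := by
  have h1 : d k C n φ = 0 := hφ
  cases m with
  | zero =>
    obtain rfl : ψ = 0 := hψ
    rw [zero_cup]; exact zero_mem _
  | succ m =>
    obtain ⟨η, rfl⟩ := hψ
    rw [← castₗ_mem_coboundaries (by omega : m + 1 + n = m + n + 1)]
    refine ⟨(-1 : k) ^ n • cup η φ, ?_⟩
    rw [map_smul, d_cup, h1, cup_zero, zero_add, smul_smul, ← mul_pow]
    simp

/-- The cup product of two cocycles. -/
def cupZ {m n : ℕ} (ψ : cocycles k C m) (φ : cocycles k C n) : cocycles k C (m + n) :=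
  ⟨cup ψ.1 φ.1, cup_mem_cocycles ψ.2 φ.2⟩

theorem cup_add {m n : ℕ} (ψ : Cochain k C m) (φ φ' : Cochain k C n) :
    cup ψ (φ + φ') = cup ψ φ + cup ψ φ' := (cupₗ k C m n ψ).map_add φ φ'

theorem cup_smul {m n : ℕ} (c : k) (ψ : Cochain k C m) (φ : Cochain k C n) :
    cup ψ (c • φ) = c • cup ψ φ := (cupₗ k C m n ψ).map_smul c φ

theorem add_cup {m n : ℕ} (ψ ψ' : Cochain k C m) (φ : Cochain k C n) :
    cup (ψ + ψ') φ = cup ψ φ + cup ψ' φ := LinearMap.map_add₂ (cupₗ k C m n) ψ ψ' φ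

theorem smul_cup {m n : ℕ} (c : k) (ψ : Cochain k C m) (φ : Cochain k C n) :
    cup (c • ψ) φ = c • cup ψ φ := LinearMap.map_smul₂ (cupₗ k C m n) c ψ φ

variable (k C) in
/-- The class of the cup product of two cocycles, as a bilinear map. -/
def cupZₗ (m n : ℕ) : cocycles k C m →ₗ[k] cocycles k C n →ₗ[k] HHn k C (m + n) :=
  LinearMap.mk₂ k (fun ψ φ => HHn.mk (cupZ ψ φ))
    (fun ψ ψ' φ => by
      have : cupZ (ψ + ψ') φ = cupZ ψ φ + cupZ ψ' φ := Subtype.ext (add_cup _ _ _)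
      rw [this, map_add])
    (fun c ψ φ => by
      have : cupZ (c • ψ) φ = c • cupZ ψ φ := Subtype.ext (smul_cup _ _ _)
      rw [this, map_smul])
    (fun ψ φ φ' => by
      have : cupZ ψ (φ + φ') = cupZ ψ φ + cupZ ψ φ' := Subtype.ext (cup_add _ _ _)
      rw [this, map_add])
    (fun c ψ φ => by
      have : cupZ ψ (c • φ) = c • cupZ ψ φ := Subtype.ext (cup_smul _ _ _)
      rw [this, map_smul])

variable (k C) in
/-- The cup product of a cocycle with a cohomology class. -/
def cupZHH (m n : ℕ) : cocycles k C m →ₗ[k] HHn k C n →ₗ[k] HHn k C (m + n) :=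
  (Submodule.liftQ ((coboundaries k C n).submoduleOf (cocycles k C n)) (cupZₗ k C m n).flip
      (fun φ hφ => LinearMap.ext fun ψ =>
        HHn.mk_eq_zero (cupZ ψ φ) (cup_mem_coboundaries_right ψ.2 hφ))).flip

theorem cupZHH_mk {m n : ℕ} (ψ : cocycles k C m) (φ : cocycles k C n) :
    cupZHH k C m n ψ (HHn.mk φ) = HHn.mk (cupZ ψ φ) := rfl

variable (k C) in
/-- The cup product in cohomology. -/
def cupHH (m n : ℕ) : HHn k C m →ₗ[k] HHn k C n →ₗ[k] HHn k C (m + n) :=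
  Submodule.liftQ ((coboundaries k C m).submoduleOf (cocycles k C m)) (cupZHH k C m n)
    (fun ψ hψ => LinearMap.ext fun a => by
      obtain ⟨φ, rfl⟩ := HHn.mk_surjective a
      exact HHn.mk_eq_zero (cupZ ψ φ) (cup_mem_coboundaries_left hψ φ.2))

theorem cupHH_mk {m n : ℕ} (ψ : cocycles k C m) (φ : cocycles k C n) :
    cupHH k C m n (HHn.mk ψ) (HHn.mk φ) = HHn.mk (cupZ ψ φ) := rfl

theorem cupOne_mem : cupOne k C ∈ cocycles k C 0 := by
  change d k C 0 (cupOne k C) = 0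
  refine Cochain.ext fun x f => ?_
  rw [d_apply, dLeft_apply, dRight_apply]
  simp [cupOne]
  rfl

variable (k C) in
/-- The unit cocycle. -/
def oneZ : cocycles k C 0 := ⟨cupOne k C, cupOne_mem⟩

theorem one_cup {n : ℕ} (φ : Cochain k C n) : cup (cupOne k C) φ ≍ φ := by
  refine cochain_ext_heq (by omega) fun x f => ?_
  rw [cup_apply]
  refine HEq.trans (heq_of_eq (Category.comp_id _)) ?_
  exact cochain_heq φ (fun i => congrArg x (Fin.ext (by simp)))
      fun i => arrow_heq f (by simp)

theorem cup_one {n : ℕ} (φ : Cochain k C n) : cup φ (cupOne k C) ≍ φ := by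
  refine cochain_ext_heq (by omega) fun x f => ?_
  rw [cup_apply]
  exact heq_of_eq (Category.id_comp _)

theorem cup_assoc {l m n : ℕ} (χ : Cochain k C l) (ψ : Cochain k C m) (φ : Cochain k C n) :
    cup (cup χ ψ) φ ≍ cup χ (cup ψ φ) := by
  refine cochain_ext_heq (by omega) fun x f => ?_
  rw [cup_apply, cup_apply, cup_apply, cup_apply]
  refine HEq.trans (heq_of_eq (Category.assoc _ _ _).symm) ?_
  refine comp_heq (congrArg x (Fin.ext (by simp; omega))) rfl rfl ?_ HEq.rfl
  refine comp_heq (congrArg x (Fin.ext (by simp; omega)))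
    (congrArg x (Fin.ext (by simp))) rfl ?_ HEq.rfl
  exact cochain_heq φ (fun i => congrArg x (Fin.ext (by simp; omega)))
      fun i => arrow_heq f (by simp; omega)

theorem HHn.mk_congr {n n' : ℕ} (h : n = n') {z : cocycles k C n} {z' : cocycles k C n'}
    (H : (z : Cochain k C n) ≍ (z' : Cochain k C n')) :
    GradedMonoid.mk (A := HHn k C) n (HHn.mk z) = GradedMonoid.mk n' (HHn.mk z') := by
  subst h
  rw [Subtype.ext (eq_of_heq H)]

theorem smul_heq {n n' : ℕ} (h : n = n') (c : k) {φ : Cochain k C n} {φ' : Cochain k C n'}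
    (H : φ ≍ φ') : c • φ ≍ c • φ' := by
  subst h
  rw [eq_of_heq H]

/-- The unit of the cohomology algebra is the class of the unit cocycle. -/
instance HHn.gOne : GradedMonoid.GOne (HHn k C) where
  one := HHn.mk (oneZ k C)

/-- The product of the cohomology algebra is the cup product. -/
instance HHn.gMul : GradedMonoid.GMul (HHn k C) where
  mul {m n} a b := cupHH k C m n a b

instance HHn.gMonoid : GradedMonoid.GMonoid (HHn k C) where
  one_mul := by
    rintro ⟨n, a⟩
    obtain ⟨z, rfl⟩ := HHn.mk_surjective a
    exact HHn.mk_congr (z := cupZ (oneZ k C) z) (zero_add n) (one_cup z.1)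
  mul_one := by
    rintro ⟨n, a⟩
    obtain ⟨z, rfl⟩ := HHn.mk_surjective a
    exact HHn.mk_congr (z := cupZ z (oneZ k C)) (add_zero n) (cup_one z.1)
  mul_assoc := by
    rintro ⟨l, a⟩ ⟨m, b⟩ ⟨n, c⟩
    obtain ⟨z, rfl⟩ := HHn.mk_surjective a
    obtain ⟨z', rfl⟩ := HHn.mk_surjective b
    obtain ⟨z'', rfl⟩ := HHn.mk_surjective c
    exact HHn.mk_congr (z := cupZ (cupZ z z') z'') (z' := cupZ z (cupZ z' z''))
      (add_assoc l m n) (cup_assoc z.1 z'.1 z''.1)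

instance HHn.gRing : DirectSum.GRing (HHn k C) where
  mul_zero {m n} a := (cupHH k C m n a).map_zero
  zero_mul {m n} b := LinearMap.map_zero₂ (cupHH k C m n) b
  mul_add {m n} a b c := (cupHH k C m n a).map_add b c
  add_mul {m n} a b c := LinearMap.map_add₂ (cupHH k C m n) a b c
  natCast n := n • HHn.mk (oneZ k C)
  natCast_zero := zero_smul _ _
  natCast_succ n := succ_nsmul _ n
  intCast z := z • HHn.mk (oneZ k C)
  intCast_ofNat n := natCast_zsmul _ n
  intCast_negSucc_ofNat n := negSucc_zsmul _ n

theorem HHn.smul_def {n : ℕ} (r : k) (z : cocycles k C n) :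
    GradedMonoid.mk (A := HHn k C) n (r • HHn.mk z) =
      GradedMonoid.mk (0 + n) (HHn.mk (cupZ (r • oneZ k C) z)) := by
  rw [← map_smul]
  refine HHn.mk_congr (z := r • z) (by omega) ?_
  change r • z.1 ≍ cup (r • cupOne k C) z.1
  rw [smul_cup]
  exact smul_heq (by omega) _ (one_cup _).symm

instance HHn.gAlgebra : DirectSum.GAlgebra k (HHn k C) where
  toFun :=
    { toFun := fun r => HHn.mk (r • oneZ k C)
      map_zero' := by rw [zero_smul, map_zero]
      map_add' := fun r s => by rw [add_smul, map_add] }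
  map_one := by
    change HHn.mk ((1 : k) • oneZ k C) = HHn.mk (oneZ k C)
    rw [one_smul]
  map_mul r s := by
    refine HHn.mk_congr (z := (r * s) • oneZ k C) (z' := cupZ (r • oneZ k C) (s • oneZ k C))
      rfl ?_
    change (r * s) • cupOne k C ≍ cup (r • cupOne k C) (s • cupOne k C)
    rw [smul_cup, cup_smul, smul_smul]
    exact smul_heq (by omega) _ (one_cup _).symm
  commutes := by
    rintro r ⟨n, a⟩
    obtain ⟨z, rfl⟩ := HHn.mk_surjective a
    refine HHn.mk_congr (z := cupZ (r • oneZ k C) z) (z' := cupZ z (r • oneZ k C))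
      (by omega) ?_
    change cup (r • cupOne k C) z.1 ≍ cup z.1 (r • cupOne k C)
    rw [smul_cup, cup_smul]
    exact smul_heq (by omega) _ ((one_cup _).trans (cup_one _).symm)
  smul_def := by
    rintro r ⟨n, a⟩
    obtain ⟨z, rfl⟩ := HHn.mk_surjective a
    exact HHn.smul_def r z

variable (k C) in
/-- Hochschild-Mitchell cohomology, the direct sum of the `HHn k C n`. By the instances above it is
a `k`-algebra under the cup product. -/
abbrev HH : Type (max u v) := DirectSum ℕ (HHn k C)

theorem HH.algHom_ext {A : Type*} [Semiring A] [Algebra k A] {f g : HH k C →ₐ[k] A}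
    (h : ∀ n (z : cocycles k C n), f (DirectSum.of _ n (HHn.mk z)) = g (DirectSum.of _ n (HHn.mk z))) :
    f = g := by
  refine DirectSum.algHom_ext _ _ fun n a => ?_
  obtain ⟨z, rfl⟩ := HHn.mk_surjective a
  exact h n z

/-- The class of a cocycle in the total cohomology. -/
def HH.cls {n : ℕ} (z : cocycles k C n) : HH k C := DirectSum.of (HHn k C) n (HHn.mk z)

end Cochains

section Maps

variable {k : Type w} [CommRing k] {C : Type u₁} [Category.{v₁} C] [Preadditive C] [Linear k C]
  {D : Type u₂} [Category.{v₂} D] [Preadditive D] [Linear k D]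

theorem map_mem_cocycles (T : ∀ n, Cochain k D n →ₗ[k] Cochain k C n)
    (hT : ∀ n φ, T (n + 1) (d k D n φ) = d k C n (T n φ)) {n : ℕ} {φ : Cochain k D n}
    (hφ : φ ∈ cocycles k D n) : T n φ ∈ cocycles k C n := by
  have h : d k D n φ = 0 := hφ
  change d k C n (T n φ) = 0
  rw [← hT, h, map_zero]

theorem map_mem_coboundaries (T : ∀ n, Cochain k D n →ₗ[k] Cochain k C n)
    (hT : ∀ n φ, T (n + 1) (d k D n φ) = d k C n (T n φ)) {n : ℕ} {φ : Cochain k D n}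
    (hφ : φ ∈ coboundaries k D n) : T n φ ∈ coboundaries k C n := by
  cases n with
  | zero =>
    obtain rfl : φ = 0 := hφ
    rw [map_zero]; exact zero_mem _
  | succ n =>
    obtain ⟨η, rfl⟩ := hφ
    exact ⟨T n η, (hT n η).symm⟩

/-- The map on cocycles given by a cochain map. -/
def mapZ (T : ∀ n, Cochain k D n →ₗ[k] Cochain k C n)
    (hT : ∀ n φ, T (n + 1) (d k D n φ) = d k C n (T n φ)) (n : ℕ) :
    cocycles k D n →ₗ[k] cocycles k C n :=
  (T n).restrict fun _ h => map_mem_cocycles T hT h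

/-- The map in cohomology given by a cochain map. -/
def mapHHn (T : ∀ n, Cochain k D n →ₗ[k] Cochain k C n)
    (hT : ∀ n φ, T (n + 1) (d k D n φ) = d k C n (T n φ)) (n : ℕ) :
    HHn k D n →ₗ[k] HHn k C n :=
  Submodule.mapQ _ _ (mapZ T hT n) fun _ h => map_mem_coboundaries T hT h

theorem mapHHn_mk (T : ∀ n, Cochain k D n →ₗ[k] Cochain k C n)
    (hT : ∀ n φ, T (n + 1) (d k D n φ) = d k C n (T n φ)) {n : ℕ} (z : cocycles k D n) :
    mapHHn T hT n (HHn.mk z) = HHn.mk (mapZ T hT n z) := rfl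

/-- The algebra map in cohomology given by a unital and multiplicative cochain map. -/
def mapHH (T : ∀ n, Cochain k D n →ₗ[k] Cochain k C n)
    (hT : ∀ n φ, T (n + 1) (d k D n φ) = d k C n (T n φ))
    (h1 : T 0 (cupOne k D) = cupOne k C)
    (hm : ∀ m n (ψ : Cochain k D m) (φ : Cochain k D n),
      T (m + n) (cup ψ φ) = cup (T m ψ) (T n φ)) :
    HH k D →ₐ[k] HH k C :=
  DirectSum.toAlgebra k (HHn k D)
    (fun n => (DirectSum.lof k ℕ (HHn k C) n).comp (mapHHn T hT n))
    (by
      change DirectSum.of (HHn k C) 0 (HHn.mk (mapZ T hT 0 (oneZ k D))) =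
        DirectSum.of (HHn k C) 0 (HHn.mk (oneZ k C))
      have : mapZ T hT 0 (oneZ k D) = oneZ k C := Subtype.ext h1
      rw [this])
    (by
      intro m n a b
      obtain ⟨ψ, rfl⟩ := HHn.mk_surjective a
      obtain ⟨φ, rfl⟩ := HHn.mk_surjective b
      change DirectSum.of (HHn k C) (m + n) (HHn.mk (mapZ T hT (m + n) (cupZ ψ φ))) =
        DirectSum.of (HHn k C) m (HHn.mk (mapZ T hT m ψ)) *
          DirectSum.of (HHn k C) n (HHn.mk (mapZ T hT n φ))
      have : mapZ T hT (m + n) (cupZ ψ φ) = cupZ (mapZ T hT m ψ) (mapZ T hT n φ) :=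
        Subtype.ext (hm m n ψ.1 φ.1)
      rw [this, DirectSum.of_mul_of]
      rfl)

theorem mapHH_cls (T : ∀ n, Cochain k D n →ₗ[k] Cochain k C n)
    (hT : ∀ n φ, T (n + 1) (d k D n φ) = d k C n (T n φ))
    (h1 : T 0 (cupOne k D) = cupOne k C)
    (hm : ∀ m n (ψ : Cochain k D m) (φ : Cochain k D n),
      T (m + n) (cup ψ φ) = cup (T m ψ) (T n φ)) {n : ℕ} (z : cocycles k D n) :
    mapHH T hT h1 hm (HH.cls z) = HH.cls (mapZ T hT n z) :=
  DirectSum.toModule_lof k n (HHn.mk z)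

/-- A cochain `φ'` on `C` lifts a cochain `φ` on `D` through `F`. -/
def Lifts (F : C ⥤ D) {n : ℕ} (φ' : Cochain k C n) (φ : Cochain k D n) : Prop :=
  ∀ (x : Fin (n + 1) → C) (f : ∀ i : Fin n, (x i.succ ⟶ x i.castSucc)),
    F.map (φ' x f) = φ (fun i => F.obj (x i)) (fun i => F.map (f i))

theorem Lifts.unique {F : C ⥤ D} [F.Faithful] {n : ℕ} {φ₁ φ₂ : Cochain k C n}
    {φ : Cochain k D n} (h₁ : Lifts F φ₁ φ) (h₂ : Lifts F φ₂ φ) : φ₁ = φ₂ :=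
  Cochain.ext fun x f => F.map_injective ((h₁ x f).trans (h₂ x f).symm)

theorem Lifts.one (F : C ⥤ D) : Lifts F (cupOne k C) (cupOne k D) := fun x _ => F.map_id (x 0)

theorem Lifts.cup {F : C ⥤ D} {m n : ℕ} {ψ' : Cochain k C m} {ψ : Cochain k D m}
    {φ' : Cochain k C n} {φ : Cochain k D n} (hψ : Lifts F ψ' ψ) (hφ : Lifts F φ' φ) :
    Lifts F (cup ψ' φ') (cup ψ φ) := by
  intro x f
  rw [cup_apply, cup_apply]
  refine (F.map_comp _ _).trans ?_
  exact congrArg₂ (· ≫ ·) (hφ _ _) (hψ _ _)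

theorem map_mergeHom (F : C ⥤ D) {n : ℕ} (x : Fin (n + 2) → C)
    (f : ∀ i : Fin (n + 1), (x i.succ ⟶ x i.castSucc)) (j : Fin n) :
    mergeHom (fun i => F.obj (x i)) (fun i => F.map (f i)) j = fun a => F.map (mergeHom x f j a) := by
  funext a
  unfold mergeHom
  split_ifs
  all_goals simp only [F.map_comp, eqToHom_map]
  all_goals rfl

theorem map_heq (F : C ⥤ D) {x y x' y' : C} {f : x ⟶ y} {f' : x' ⟶ y'} (hx : x = x')
    (hy : y = y') (h : f ≍ f') : F.map f ≍ F.map f' := by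
  subst hx hy
  rw [eq_of_heq h]

theorem Lifts.d {F : C ⥤ D} [F.Additive] [F.Linear k] {n : ℕ} {φ' : Cochain k C n}
    {φ : Cochain k D n} (h : Lifts F φ' φ) : Lifts F (d k C n φ') (d k D n φ) := by
  intro x f
  rw [d_apply, d_apply, F.map_add, F.map_add, F.map_sum, F.map_smul]
  refine congrArg₂ (· + ·) (congrArg₂ (· + ·) (congrArg _ ?_)
    (Finset.sum_congr rfl fun j _ => ?_)) ?_
  · exact (F.map_comp _ _).trans (congrArg (· ≫ F.map (f 0)) (h _ _))
  · rw [F.map_smul]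
    refine congrArg _ (eq_of_heq (HEq.trans ?_ (dMiddle_heq _ _ _ _).symm))
    refine (map_heq F (mergeObj_gt x j (Fin.last n) j.2).symm (mergeObj_lt x j 0 (Nat.zero_le _)).symm
      (dMiddle_heq j φ' x f)).trans ((heq_of_eq (h _ _)).trans ?_)
    rw [map_mergeHom]
    rfl
  · exact (F.map_comp _ _).trans (congrArg (F.map (f (Fin.last n)) ≫ ·) (h _ _))

variable (k) in
/-- The `k`-isomorphism on morphism spaces given by a fully faithful `k`-functor. -/
def homIso (F : C ⥤ D) [F.Additive] [F.Linear k] [F.Full] [F.Faithful] (x y : C) :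
    (x ⟶ y) ≃ₗ[k] (F.obj x ⟶ F.obj y) :=
  LinearEquiv.ofBijective (F.mapLinearMap k) ⟨F.map_injective, F.map_surjective⟩

variable (k) in
/-- The map induced on cochains by a fully faithful `k`-functor: the value of the image of `φ`
at `f₀, …, fₙ₋₁` is `F⁻¹ (φ (F f₀, …, F fₙ₋₁))`. -/
def cochainMap (F : C ⥤ D) [F.Additive] [F.Linear k] [F.Full] [F.Faithful] (n : ℕ) :
    Cochain k D n →ₗ[k] Cochain k C n where
  toFun φ := fun x => (homIso k F (x (Fin.last n)) (x 0)).symm.toLinearMap.compMultilinearMap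
    ((φ (fun i => F.obj (x i))).compLinearMap (fun _ => F.mapLinearMap k))
  map_add' _ _ := Cochain.ext fun x _ =>
    (homIso k F (x (Fin.last n)) (x 0)).symm.map_add _ _
  map_smul' c _ := Cochain.ext fun x _ =>
    (homIso k F (x (Fin.last n)) (x 0)).symm.map_smul c _

theorem cochainMap_apply (F : C ⥤ D) [F.Additive] [F.Linear k] [F.Full] [F.Faithful] {n : ℕ}
    (φ : Cochain k D n) (x : Fin (n + 1) → C) (f : ∀ i : Fin n, (x i.succ ⟶ x i.castSucc)) :
    cochainMap k F n φ x f = (homIso k F (x (Fin.last n)) (x 0)).symm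
      (φ (fun i => F.obj (x i)) (fun i => F.map (f i))) := rfl

end Maps

section Action

/-- A `k`-linear category `C` with a (strict) action of the group `G` by `k`-linear automorphisms.
The action on objects is the `MulAction`; `act s` is the action of `s` on morphisms. The
`eqToHom`s only express that `1 • x = x` and `(s * t) • x = s • t • x`. -/
class GkCategory (k : Type w) (G : Type g) (C : Type u) [CommRing k] [Group G]
    [Category.{v} C] [Preadditive C] [Linear k C] [MulAction G C] where
  act (s : G) {x y : C} : (x ⟶ y) →ₗ[k] (s • x ⟶ s • y)
  act_id (s : G) (x : C) : act s (𝟙 x) = 𝟙 (s • x)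
  act_comp (s : G) {x y z : C} (f : x ⟶ y) (h : y ⟶ z) : act s (f ≫ h) = act s f ≫ act s h
  one_act {x y : C} (f : x ⟶ y) :
    act 1 f = eqToHom (one_smul G x) ≫ f ≫ eqToHom (one_smul G y).symm
  mul_act (s t : G) {x y : C} (f : x ⟶ y) :
    act (s * t) f = eqToHom (mul_smul s t x) ≫ act s (act t f) ≫ eqToHom (mul_smul s t y).symm

variable {k : Type w} {G : Type g} {C : Type u} [CommRing k] [Group G]
  [Category.{v} C] [Preadditive C] [Linear k C] [MulAction G C] [GkCategory k G C]

variable (k) in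
/-- The action of `s` on morphisms, with `k` explicit. -/
def hom (s : G) {x y : C} : (x ⟶ y) →ₗ[k] (s • x ⟶ s • y) := GkCategory.act s

variable (k) in
/-- The automorphism of `C` given by `s`. -/
def actFunctor (s : G) : C ⥤ C where
  obj x := s • x
  map f := hom k s f
  map_id := GkCategory.act_id (k := k) s
  map_comp := GkCategory.act_comp (k := k) s

instance (s : G) : (actFunctor k s : C ⥤ C).Additive where
  map_add := map_add _ _ _

instance (s : G) : (actFunctor k s : C ⥤ C).Linear k where
  map_smul f r := map_smul _ r f

theorem hom_heq (s : G) {x y x' y' : C} {f : x ⟶ y} {f' : x' ⟶ y'} (hx : x = x') (hy : y = y')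
    (h : f ≍ f') : hom k s f ≍ hom k s f' := by
  subst hx hy
  rw [eq_of_heq h]

theorem hom_heq' {s t : G} (h : s = t) {x y : C} (f : x ⟶ y) : hom k s f ≍ hom k t f := by
  subst h; rfl

theorem hom_one_heq {x y : C} (f : x ⟶ y) : hom k (1 : G) f ≍ f := by
  unfold hom
  rw [GkCategory.one_act, eqToHom_comp_heq_iff]
  exact comp_eqToHom_heq _ _

theorem hom_mul_heq (s t : G) {x y : C} (f : x ⟶ y) :
    hom k (s * t) f ≍ hom k s (hom k t f) := by
  unfold hom
  rw [GkCategory.mul_act, eqToHom_comp_heq_iff]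
  exact comp_eqToHom_heq _ _

theorem hom_inv_hom (s : G) {x y : C} (f : x ⟶ y) : hom k s⁻¹ (hom k s f) ≍ f :=
  (hom_mul_heq _ _ _).symm.trans ((hom_heq' (inv_mul_cancel s) f).trans (hom_one_heq f))

theorem hom_hom_inv (s : G) {x y : C} (f : x ⟶ y) : hom k s (hom k s⁻¹ f) ≍ f :=
  (hom_mul_heq _ _ _).symm.trans ((hom_heq' (mul_inv_cancel s) f).trans (hom_one_heq f))

instance (s : G) : (actFunctor k s : C ⥤ C).Faithful where
  map_injective {x y f f'} h := by
    have h' : hom k s f = hom k s f' := h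
    exact eq_of_heq ((hom_inv_hom s f).symm.trans ((heq_of_eq (by rw [h'])).trans (hom_inv_hom s f')))

variable (k C) in
/-- The action of `s` on cochains: `(s • φ)(f₀, …, fₙ₋₁) = s (φ(s⁻¹ f₀, …, s⁻¹ fₙ₋₁))`, where
the `eqToHom`s identify `s • s⁻¹ • y` with `y`. -/
def cochainAct (s : G) (n : ℕ) : Cochain k C n →ₗ[k] Cochain k C n where
  toFun φ := fun y =>
    ((sandwich k (eqToHom (smul_inv_smul s (y (Fin.last n))).symm)
      (eqToHom (smul_inv_smul s (y 0)))).comp (hom k s)).compMultilinearMap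
      ((φ (fun i => s⁻¹ • y i)).compLinearMap (fun _ => hom k s⁻¹))
  map_add' φ ψ := Cochain.ext fun y f => LinearMap.map_add
    ((sandwich k (eqToHom (smul_inv_smul s (y (Fin.last n))).symm)
      (eqToHom (smul_inv_smul s (y 0)))).comp (hom k s)) _ _
  map_smul' c φ := Cochain.ext fun y f => LinearMap.map_smul
    ((sandwich k (eqToHom (smul_inv_smul s (y (Fin.last n))).symm)
      (eqToHom (smul_inv_smul s (y 0)))).comp (hom k s)) c _

theorem cochainAct_apply (s : G) {n : ℕ} (φ : Cochain k C n) (y : Fin (n + 1) → C)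
    (f : ∀ i : Fin n, (y i.succ ⟶ y i.castSucc)) :
    cochainAct k C s n φ y f = eqToHom (smul_inv_smul s (y (Fin.last n))).symm ≫
      hom k s (φ (fun i => s⁻¹ • y i) (fun i => hom k s⁻¹ (f i))) ≫
        eqToHom (smul_inv_smul s (y 0)) := rfl

theorem cochainAct_heq (s : G) {n : ℕ} (φ : Cochain k C n) (y : Fin (n + 1) → C)
    (f : ∀ i : Fin n, (y i.succ ⟶ y i.castSucc)) :
    cochainAct k C s n φ y f ≍
      hom k s (φ (fun i => s⁻¹ • y i) (fun i => hom k s⁻¹ (f i))) := by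
  rw [cochainAct_apply, eqToHom_comp_heq_iff]
  exact comp_eqToHom_heq _ _

theorem cochainAct_lifts (s : G) {n : ℕ} (φ : Cochain k C n) :
    Lifts (actFunctor k s⁻¹) (cochainAct k C s n φ) φ := by
  intro x f
  refine eq_of_heq (HEq.trans (hom_heq s⁻¹ ?_ ?_ (cochainAct_heq s φ x f)) (hom_inv_hom s _))
  · simp
  · simp

theorem d_cochainAct (s : G) (n : ℕ) (φ : Cochain k C n) :
    cochainAct k C s (n + 1) (d k C n φ) = d k C n (cochainAct k C s n φ) :=
  (cochainAct_lifts s _).unique (cochainAct_lifts s φ).d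

theorem cochainAct_one (s : G) : cochainAct k C s 0 (cupOne k C) = cupOne k C :=
  (cochainAct_lifts s _).unique (Lifts.one _)

theorem cochainAct_cup (s : G) (m n : ℕ) (ψ : Cochain k C m) (φ : Cochain k C n) :
    cochainAct k C s (m + n) (cup ψ φ) = cup (cochainAct k C s m ψ) (cochainAct k C s n φ) :=
  (cochainAct_lifts s _).unique ((cochainAct_lifts s ψ).cup (cochainAct_lifts s φ))

theorem one_cochainAct (n : ℕ) (φ : Cochain k C n) : cochainAct k C (1 : G) n φ = φ := by
  refine Cochain.ext fun x f => eq_of_heq ?_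
  refine (cochainAct_heq _ _ _ _).trans ((hom_one_heq _).trans ?_)
  exact cochain_heq φ (fun i => by simp) fun i =>
    (hom_heq' inv_one (f i)).trans (hom_one_heq (f i))

theorem mul_cochainAct (s t : G) (n : ℕ) (φ : Cochain k C n) :
    cochainAct k C (s * t) n φ = cochainAct k C s n (cochainAct k C t n φ) := by
  refine Cochain.ext fun x f => eq_of_heq ?_
  refine (cochainAct_heq _ _ _ _).trans (HEq.trans ?_ (cochainAct_heq _ _ _ _).symm)
  refine (hom_mul_heq _ _ _).trans (hom_heq s ?_ ?_ ?_)
  · simp [mul_smul]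
  · simp [mul_smul]
  · refine HEq.trans (hom_heq t ?_ ?_ ?_) (cochainAct_heq _ _ _ _).symm
    · simp [mul_smul]
    · simp [mul_smul]
    · exact cochain_heq φ (fun i => by simp [mul_smul]) fun i =>
        (hom_heq' (mul_inv_rev s t) (f i)).trans (hom_mul_heq _ _ _)

variable (k C) in
/-- The algebra endomorphism of `HH k C` given by `s`. -/
def HH.act (s : G) : HH k C →ₐ[k] HH k C :=
  mapHH (cochainAct k C s) (d_cochainAct s) (cochainAct_one s) (cochainAct_cup s)

theorem HH.act_cls (s : G) {n : ℕ} (z : cocycles k C n) :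
    HH.act k C s (HH.cls z) = HH.cls (mapZ (cochainAct k C s) (d_cochainAct s) n z) :=
  mapHH_cls _ (d_cochainAct s) (cochainAct_one s) (cochainAct_cup s) z

variable (k G C) in
/-- The action of `G` on `HH k C`, by algebra automorphisms. -/
def HH.action : G →* (HH k C ≃ₐ[k] HH k C) :=
  (AlgEquiv.algHomUnitsEquiv k (HH k C)).toMonoidHom.comp <| MonoidHom.toHomUnits
    { toFun := fun s => HH.act k C s
      map_one' := HH.algHom_ext fun n z => by
        refine (HH.act_cls (1 : G) z).trans ?_
        exact congrArg HH.cls (Subtype.ext (one_cochainAct n z.1))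
      map_mul' := fun s t => HH.algHom_ext fun n z => by
        refine (HH.act_cls (s * t) z).trans ?_
        refine Eq.trans ?_ (congrArg (HH.act k C s) (HH.act_cls t z)).symm
        refine Eq.trans ?_ (HH.act_cls s _).symm
        exact congrArg HH.cls (Subtype.ext (mul_cochainAct s t n z.1)) }

theorem HH.action_cls (s : G) {n : ℕ} (z : cocycles k C n) :
    HH.action k G C s (HH.cls z) = HH.cls (mapZ (cochainAct k C s) (d_cochainAct s) n z) :=
  HH.act_cls s z

/-- A functor between categories with a `G`-action commutes with the actions, on objects and on
morphisms. -/
structure IsGFunctor (k : Type w) (G : Type g) [CommRing k] [Group G]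
    {C : Type u₁} [Category.{v₁} C] [Preadditive C] [Linear k C] [MulAction G C]
    [GkCategory k G C]
    {D : Type u₂} [Category.{v₂} D] [Preadditive D] [Linear k D] [MulAction G D]
    [GkCategory k G D] (F : C ⥤ D) : Prop where
  obj_smul (s : G) (x : C) : F.obj (s • x) = s • F.obj x
  map_hom (s : G) {x y : C} (f : x ⟶ y) :
    F.map (hom k s f) =
      eqToHom (obj_smul s x) ≫ hom k s (F.map f) ≫ eqToHom (obj_smul s y).symm

end Action

end HochschildMitchell

end

noncomputable section

namespace HochschildMitchell

section Homotopy

universe w u v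

variable {k : Type w} [CommRing k] {C : Type u} [Category.{v} C] [Preadditive C] [Linear k C]

/-- The sequence `H (x 0), …, H (x i), x i, …, x n`. -/
def insertObj (H : C ⥤ C) {n : ℕ} (x : Fin (n + 1) → C) (i : Fin (n + 1)) : Fin (n + 2) → C :=
  fun a => if h : a.1 ≤ i.1 then H.obj (x ⟨a.1, by omega⟩) else x ⟨a.1 - 1, by omega⟩

theorem insertObj_le (H : C ⥤ C) {n : ℕ} (x : Fin (n + 1) → C) (i : Fin (n + 1))
    {a : Fin (n + 2)} (b : Fin (n + 1)) (h : a.1 ≤ i.1) (hb : a.1 = b.1) :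
    insertObj H x i a = H.obj (x b) := by
  unfold insertObj
  rw [dif_pos h]
  exact congrArg (fun c => H.obj (x c)) (Fin.ext hb)

theorem insertObj_gt (H : C ⥤ C) {n : ℕ} (x : Fin (n + 1) → C) (i : Fin (n + 1))
    {a : Fin (n + 2)} (b : Fin (n + 1)) (h : i.1 < a.1) (hb : a.1 = b.1 + 1) :
    insertObj H x i a = x b := by
  unfold insertObj
  rw [dif_neg (by omega)]
  exact congrArg x (Fin.ext (by simp; omega))

variable {H : C ⥤ C} (e : ∀ x, x ≅ H.obj x)

/-- The composable sequence `H (f 0), …, H (f (i - 1)), e (x i), f i, …, f (n - 1)`. -/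
def insertHom {n : ℕ} (x : Fin (n + 1) → C) (f : ∀ i : Fin n, (x i.succ ⟶ x i.castSucc))
    (i a : Fin (n + 1)) : (insertObj H x i a.succ ⟶ insertObj H x i a.castSucc) :=
  if h : a.1 < i.1 then
    eqToHom (insertObj_le H x i (Fin.succ ⟨a.1, by omega⟩) (by simp; omega) (by simp)) ≫
      H.map (f ⟨a.1, by omega⟩) ≫
      eqToHom (insertObj_le H x i (Fin.castSucc ⟨a.1, by omega⟩) (by simp; omega) (by simp)).symm
  else if h' : a.1 = i.1 then
    eqToHom (insertObj_gt H x i i (by simp; omega) (by simp; omega)) ≫ (e (x i)).hom ≫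
      eqToHom (insertObj_le H x i i (by simp; omega) (by simp; omega)).symm
  else
    eqToHom (insertObj_gt H x i (Fin.succ ⟨a.1 - 1, by omega⟩)
        (by simp; omega) (by simp; omega)) ≫
      f ⟨a.1 - 1, by omega⟩ ≫
      eqToHom (insertObj_gt H x i (Fin.castSucc ⟨a.1 - 1, by omega⟩)
        (by simp; omega) (by simp; omega)).symm

variable {e} in
theorem insertHom_lt {n : ℕ} {x : Fin (n + 1) → C} {f : ∀ i : Fin n, (x i.succ ⟶ x i.castSucc)}
    {i a : Fin (n + 1)} (b : Fin n) (h : a.1 < i.1) (hb : a.1 = b.1) :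
    insertHom e x f i a ≍ H.map (f b) := by
  obtain ⟨b, _⟩ := b
  obtain rfl : a.1 = b := hb
  unfold insertHom
  rw [dif_pos h, eqToHom_comp_heq_iff]
  exact comp_eqToHom_heq _ _

variable {e} in
theorem insertHom_eq {n : ℕ} {x : Fin (n + 1) → C} {f : ∀ i : Fin n, (x i.succ ⟶ x i.castSucc)}
    {i a : Fin (n + 1)} (h : a.1 = i.1) :
    insertHom e x f i a ≍ (e (x i)).hom := by
  unfold insertHom
  rw [dif_neg (by omega), dif_pos h, eqToHom_comp_heq_iff]
  exact comp_eqToHom_heq _ _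

variable {e} in
theorem insertHom_gt {n : ℕ} {x : Fin (n + 1) → C} {f : ∀ i : Fin n, (x i.succ ⟶ x i.castSucc)}
    {i a : Fin (n + 1)} (b : Fin n) (h : i.1 < a.1) (hb : a.1 = b.1 + 1) :
    insertHom e x f i a ≍ f b := by
  obtain ⟨b, _⟩ := b
  obtain rfl : b = a.1 - 1 := by simp only at hb; omega
  unfold insertHom
  rw [dif_neg (by omega), dif_neg (by omega), eqToHom_comp_heq_iff]
  exact comp_eqToHom_heq _ _

theorem insertHom_update (k : Type w) [CommRing k] [Linear k C] [H.Additive] [H.Linear k] {n : ℕ}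
    (x : Fin (n + 1) → C) (f : ∀ i : Fin n, (x i.succ ⟶ x i.castSucc)) (i : Fin (n + 1))
    (b : Fin n) :
    ∃ (a : Fin (n + 1)) (L : (x b.succ ⟶ x b.castSucc) →ₗ[k]
        (insertObj H x i a.succ ⟶ insertObj H x i a.castSucc)),
      ∀ c, insertHom e x (Function.update f b c) i =
        Function.update (insertHom e x f i) a (L c) := by
  have key : ∀ (a : Fin (n + 1)) (L : (x b.succ ⟶ x b.castSucc) →ₗ[k]
        (insertObj H x i a.succ ⟶ insertObj H x i a.castSucc)),
      (∀ c, insertHom e x (Function.update f b c) i a = L c) →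
      (∀ a' : Fin (n + 1), a' ≠ a → a'.1 < i.1 → a'.1 ≠ b.1) →
      (∀ a' : Fin (n + 1), a' ≠ a → i.1 < a'.1 → a'.1 - 1 ≠ b.1) →
      ∃ (a : Fin (n + 1)) (L : (x b.succ ⟶ x b.castSucc) →ₗ[k]
        (insertObj H x i a.succ ⟶ insertObj H x i a.castSucc)),
      ∀ c, insertHom e x (Function.update f b c) i =
        Function.update (insertHom e x f i) a (L c) := by
    intro a L hL h1 h2
    refine ⟨a, L, fun c => ?_⟩
    funext a'
    by_cases ha : a' = a
    · subst ha; simp [hL]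
    · rw [Function.update_of_ne ha]
      unfold insertHom
      split_ifs with h h'
      · rw [Function.update_of_ne (fun h'' => h1 a' ha h (congrArg Fin.val h''))]
      · rfl
      · rw [Function.update_of_ne
          (fun h'' => h2 a' ha (by omega) (congrArg Fin.val h''))]
  rcases lt_or_ge b.1 i.1 with h | h
  · refine key b.castSucc ((sandwich k
      (eqToHom (insertObj_le H x i b.succ (by simp; omega) (by simp)))
      (eqToHom (insertObj_le H x i b.castSucc (by simp; omega) (by simp)).symm)).comp
        (H.mapLinearMap k)) (fun c => ?_) ?_ ?_
    · unfold insertHom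
      rw [dif_pos (by simpa using h)]
      simp [sandwich]
    · intro a' h1 h2 h3
      exact h1 (Fin.ext h3)
    · intro a' h1 h2 h3
      omega
  · refine key b.succ (sandwich k
      (eqToHom (insertObj_gt H x i b.succ (by simp; omega) (by simp)))
      (eqToHom (insertObj_gt H x i b.castSucc (by simp; omega) (by simp)).symm))
        (fun c => ?_) ?_ ?_
    · unfold insertHom
      rw [dif_neg (by simp; omega), dif_neg (by simp; omega)]
      simp [sandwich]
    · intro a' h1 h2 h3
      omega
    · intro a' h1 h2 h3
      exact h1 (Fin.ext (by simp; omega))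

/-- `f₀, …, fₙ₋₁ ↦ e⁻¹ ∘ φ(H f₀, …, H fᵢ₋₁, e, fᵢ, …, fₙ₋₁)`. -/
def insertAt [H.Additive] [H.Linear k] {n : ℕ} (i : Fin (n + 1)) :
    Cochain k C (n + 1) →ₗ[k] Cochain k C n where
  toFun φ := fun x => mkMulti (fun f =>
    sandwich k (eqToHom (insertObj_gt H x i (Fin.last n) (by simp; omega) (by simp)).symm)
      (eqToHom (insertObj_le H x i 0 (by simp) (by simp)) ≫ (e (x 0)).inv)
      (φ (insertObj H x i) (insertHom e x f i))) (by
    intro f b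
    obtain ⟨a, L, hL⟩ := insertHom_update e k x f i b
    refine ⟨((sandwich k (eqToHom (insertObj_gt H x i (Fin.last n) (by simp; omega) (by simp)).symm)
      (eqToHom (insertObj_le H x i 0 (by simp) (by simp)) ≫ (e (x 0)).inv)).comp
      ((φ (insertObj H x i)).toLinearMap (insertHom e x f i) a)).comp L, fun c => ?_⟩
    rw [hL]
    rfl)
  map_add' _ _ := Cochain.ext fun _ _ => (sandwich k _ _).map_add _ _
  map_smul' _ _ := Cochain.ext fun _ _ => (sandwich k _ _).map_smul _ _

variable [H.Additive] [H.Linear k]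

theorem insertAt_comp {n : ℕ} (i : Fin (n + 1)) (φ : Cochain k C (n + 1)) (x : Fin (n + 1) → C)
    (f : ∀ i : Fin n, (x i.succ ⟶ x i.castSucc)) :
    insertAt e i φ x f ≫ (e (x 0)).hom ≍ φ (insertObj H x i) (insertHom e x f i) := by
  change (eqToHom _ ≫ (φ (insertObj H x i) (insertHom e x f i)) ≫ eqToHom _ ≫ (e (x 0)).inv) ≫ _ ≍ _
  simp only [Category.assoc, Iso.inv_hom_id, Category.comp_id]
  rw [eqToHom_comp_heq_iff]
  exact comp_eqToHom_heq _ _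

variable {e} in
theorem ext_comp_hom {n : ℕ} {φ φ' : Cochain k C n}
    (h : ∀ x f, φ x f ≫ (e (x 0)).hom ≍ φ' x f ≫ (e (x 0)).hom) : φ = φ' :=
  Cochain.ext fun x f => (cancel_mono _).1 (eq_of_heq (h x f))

theorem iso_hom_heq {x y : C} (h : x = y) : (e x).hom ≍ (e y).hom := by
  subst h; rfl

theorem comp_comp_hom
    (he : ∀ {x y : C} (f : x ⟶ y), f ≫ (e y).hom = (e x).hom ≫ H.map f)
    {x y z : C} (g : z ⟶ x) (f : x ⟶ y) :
    (g ≫ f) ≫ (e y).hom = (g ≫ (e x).hom) ≫ H.map f := by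
  rw [Category.assoc, he, Category.assoc]

theorem insertAt_dLeft
    (he : ∀ {x y : C} (f : x ⟶ y), f ≫ (e y).hom = (e x).hom ≫ H.map f)
    {n : ℕ} (i : Fin (n + 1)) (φ : Cochain k C (n + 1)) :
    insertAt e i.succ (dLeft φ) = dLeft (insertAt e i φ) := by
  refine ext_comp_hom (e := e) fun x f => (insertAt_comp _ _ _ _ _).trans ?_
  rw [dLeft_apply, dLeft_apply]
  refine HEq.trans ?_ (heq_of_eq (comp_comp_hom e he _ _).symm)
  refine comp_heq ?_ ?_ ?_ (HEq.trans ?_ (insertAt_comp e i φ _ _).symm)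
    (insertHom_lt 0 (by simp) (by simp))
  · rw [insertObj_gt H x _ (Fin.last (n + 1)) (by simp; omega) (by simp)]
  · rw [insertObj_le H x _ 1 (by simp) (by simp)]; rfl
  · rw [insertObj_le H x _ 0 (by simp) (by simp)]
  · refine cochain_heq φ (fun a => ?_) (fun a => ?_)
    · rcases le_or_gt a.1 i.1 with h | h
      · rw [insertObj_le H x _ (Fin.succ ⟨a, by omega⟩) (by simpa using h) (by simp),
          insertObj_le H (fun i => x i.succ) _ ⟨a, by omega⟩ h rfl]
      · rw [insertObj_gt H x _ (Fin.succ ⟨a - 1, by omega⟩) (by simpa using h) (by simp; omega),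
          insertObj_gt H (fun i => x i.succ) _ ⟨a - 1, by omega⟩ h (by simp; omega)]
    · rcases lt_trichotomy a.1 i.1 with h | h | h
      · exact (insertHom_lt (Fin.succ ⟨a, by omega⟩) (by simpa using h) (by simp)).trans
          (insertHom_lt (x := fun i => x i.succ) (f := fun i => f i.succ) ⟨a, by omega⟩ h rfl).symm
      · exact (insertHom_eq (by simpa using h)).trans
          (insertHom_eq (x := fun i => x i.succ) (f := fun i => f i.succ) h).symm
      · exact (insertHom_gt (Fin.succ ⟨a - 1, by omega⟩) (by simpa using h) (by simp; omega)).trans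
          (insertHom_gt (x := fun i => x i.succ) (f := fun i => f i.succ) ⟨a - 1, by omega⟩ h
            (by simp; omega)).symm

theorem insertAt_zero_dLeft {n : ℕ} (φ : Cochain k C n) : insertAt e 0 (dLeft φ) = φ := by
  refine ext_comp_hom (e := e) fun x f => (insertAt_comp _ _ _ _ _).trans ?_
  rw [dLeft_apply]
  refine comp_heq ?_ ?_ ?_ ?_ (insertHom_eq rfl)
  · exact insertObj_gt H x _ _ (by simp) (by simp)
  · exact insertObj_gt H x _ _ (by simp) (by simp)
  · exact insertObj_le H x _ _ (by simp) (by simp)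
  · exact cochain_heq φ (fun a => insertObj_gt H x _ _ (by simp) (by simp))
      fun a => insertHom_gt _ (by simp) (by simp)

theorem insertAt_dRight {n : ℕ} (i : Fin (n + 1)) (φ : Cochain k C (n + 1)) :
    insertAt e i.castSucc (dRight φ) = dRight (insertAt e i φ) := by
  refine ext_comp_hom (e := e) fun x f => (insertAt_comp _ _ _ _ _).trans ?_
  rw [dRight_apply, dRight_apply]
  refine HEq.trans ?_ (heq_of_eq (Category.assoc _ _ _).symm)
  refine comp_heq ?_ ?_ ?_ (insertHom_gt _ (by simp; omega) (by simp))
    (HEq.trans ?_ (insertAt_comp e i φ _ _).symm)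
  · exact insertObj_gt H x _ _ (by simp) (by simp)
  · exact insertObj_gt H x _ _ (by simp; omega) (by simp)
  · exact insertObj_le H x _ _ (by simp) (by simp)
  · refine cochain_heq φ (fun a => ?_) (fun a => ?_)
    · rcases le_or_gt a.1 i.1 with h | h
      · rw [insertObj_le H x _ (Fin.castSucc ⟨a, by omega⟩) (by simpa using h) (by simp),
          insertObj_le H (fun i => x i.castSucc) _ ⟨a, by omega⟩ h rfl]
      · rw [insertObj_gt H x _ (Fin.castSucc ⟨a - 1, by omega⟩) (by simpa using h) (by simp; omega),
          insertObj_gt H (fun i => x i.castSucc) _ ⟨a - 1, by omega⟩ h (by simp; omega)]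
    · rcases lt_trichotomy a.1 i.1 with h | h | h
      · exact (insertHom_lt (Fin.castSucc ⟨a, by omega⟩) (by simpa using h) (by simp)).trans
          (insertHom_lt (x := fun i => x i.castSucc) (f := fun i => f i.castSucc)
            ⟨a, by omega⟩ h rfl).symm
      · exact (insertHom_eq (by simpa using h)).trans
          (insertHom_eq (x := fun i => x i.castSucc) (f := fun i => f i.castSucc) h).symm
      · exact (insertHom_gt (Fin.castSucc ⟨a - 1, by omega⟩) (by simpa using h)
          (by simp; omega)).trans
          (insertHom_gt (x := fun i => x i.castSucc) (f := fun i => f i.castSucc)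
            ⟨a - 1, by omega⟩ h (by simp; omega)).symm

theorem insertAt_last_dRight
    (he : ∀ {x y : C} (f : x ⟶ y), f ≫ (e y).hom = (e x).hom ≫ H.map f)
    {n : ℕ} {φ' φ : Cochain k C n} (h : Lifts H φ' φ) :
    insertAt e (Fin.last n) (dRight φ) = φ' := by
  refine ext_comp_hom (e := e) fun x f => (insertAt_comp _ _ _ _ _).trans ?_
  rw [dRight_apply, he, h x f]
  refine comp_heq ?_ ?_ ?_ (insertHom_eq rfl) ?_
  · exact insertObj_gt H x _ _ (by simp) (by simp)
  · exact insertObj_le H x _ _ (by simp) (by simp)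
  · exact insertObj_le H x _ _ (by simp) (by simp)
  · exact cochain_heq φ (fun a => insertObj_le H x _ _ (by simp; omega) (by simp))
      fun a => insertHom_lt _ (by simp) (by simp)

theorem insertAt_dMiddle_self
    (he : ∀ {x y : C} (f : x ⟶ y), f ≫ (e y).hom = (e x).hom ≫ H.map f)
    {n : ℕ} (i : Fin n) (φ : Cochain k C n) :
    insertAt e i.castSucc (dMiddle i φ) = insertAt e i.succ (dMiddle i φ) := by
  refine ext_comp_hom (e := e) fun x f => (insertAt_comp _ _ _ _ _).trans
    (HEq.trans ?_ (insertAt_comp _ _ _ _ _).symm)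
  refine (dMiddle_heq _ _ _ _).trans (HEq.trans ?_ (dMiddle_heq _ _ _ _).symm)
  refine cochain_heq φ (fun a => ?_) (fun a => ?_)
  · rcases le_or_gt a.1 i.1 with h | h
    · rw [mergeObj_lt _ _ _ h, mergeObj_lt _ _ _ h,
        insertObj_le H x _ a (by simpa using h) (by simp),
        insertObj_le H x _ a (by simp; omega) (by simp)]
    · rw [mergeObj_gt _ _ _ h, mergeObj_gt _ _ _ h,
        insertObj_gt H x _ a (by simp; omega) (by simp),
        insertObj_gt H x _ a (by simp; omega) (by simp)]
  · rcases lt_trichotomy a.1 i.1 with h | h | h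
    · refine (mergeHom_lt _ _ _ _ h).trans (HEq.trans ?_ (mergeHom_lt _ _ _ _ h).symm)
      exact (insertHom_lt a (by simpa using h) (by simp)).trans
        (insertHom_lt a (by simp; omega) (by simp)).symm
    · obtain rfl : a = i := Fin.ext h
      refine (mergeHom_eq _ _ _ _ rfl).trans (HEq.trans ?_ (mergeHom_eq _ _ _ _ rfl).symm)
      refine (comp_heq (f' := f a) (h' := (e (x a.castSucc)).hom) ?_ ?_ ?_
        (insertHom_gt a (by simp) (by simp)) (insertHom_eq (by simp))).trans ?_
      · exact insertObj_gt H x _ _ (by simp) (by simp)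
      · exact insertObj_gt H x _ _ (by simp) (by simp)
      · exact insertObj_le H x _ _ (by simp) (by simp)
      rw [he]
      refine comp_heq ?_ ?_ ?_ (insertHom_eq (by simp)).symm (insertHom_lt a (by simp) (by simp)).symm
      · exact (insertObj_gt H x _ _ (by simp) (by simp)).symm
      · exact (insertObj_le H x _ _ (by simp) (by simp)).symm
      · exact (insertObj_le H x _ _ (by simp) (by simp)).symm
    · refine (mergeHom_gt _ _ _ _ h).trans (HEq.trans ?_ (mergeHom_gt _ _ _ _ h).symm)
      exact (insertHom_gt a (by simp; omega) (by simp)).trans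
        (insertHom_gt a (by simpa using h) (by simp)).symm

theorem insertAt_dMiddle_of_heq {n : ℕ} (i : Fin (n + 2)) (j : Fin (n + 1)) (i' : Fin (n + 1))
    (j' : Fin n) (φ : Cochain k C (n + 1))
    (hobj : ∀ (x : Fin (n + 2) → C) a,
      mergeObj (insertObj H x i) j a = insertObj H (mergeObj x j') i' a)
    (hhom : ∀ (x : Fin (n + 2) → C) (f : ∀ i : Fin (n + 1), (x i.succ ⟶ x i.castSucc)) a,
      mergeHom (insertObj H x i) (insertHom e x f i) j a ≍
        insertHom e (mergeObj x j') (mergeHom x f j') i' a) :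
    insertAt e i (dMiddle j φ) = dMiddle j' (insertAt e i' φ) := by
  refine ext_comp_hom (e := e) fun x f => (insertAt_comp _ _ _ _ _).trans ?_
  have h0 : mergeObj x j' 0 = x 0 := mergeObj_lt x j' 0 (Nat.zero_le _)
  refine HEq.trans ?_ (comp_heq (mergeObj_gt x j' (Fin.last n) j'.2) h0
    (congrArg H.obj h0) (dMiddle_heq j' (insertAt e i' φ) x f).symm (iso_hom_heq e h0))
  refine HEq.trans ?_ (insertAt_comp _ _ _ _ _).symm
  exact (dMiddle_heq _ _ _ _).trans (cochain_heq φ (hobj x) (hhom x f))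

theorem mergeObj_insertObj_lt {n : ℕ} (i : Fin (n + 1)) (j : Fin n) (hij : j.1 < i.1)
    (x : Fin (n + 2) → C) (a : Fin (n + 2)) :
    mergeObj (insertObj H x i.succ) j.castSucc a = insertObj H (mergeObj x j) i a := by
  rcases le_or_gt a.1 j.1 with h | h
  · rw [mergeObj_lt _ _ _ (by simpa using h),
      insertObj_le H x _ ⟨a, by omega⟩ (by simp; omega) (by simp),
      insertObj_le H _ _ ⟨a, by omega⟩ (by omega) rfl, mergeObj_lt _ _ _ (by simpa using h)]
    rfl
  rw [mergeObj_gt _ _ _ (by simpa using h)]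
  rcases le_or_gt a.1 i.1 with h' | h'
  · rw [insertObj_le H x _ (Fin.succ ⟨a, by omega⟩) (by simp; omega) (by simp),
      insertObj_le H _ _ ⟨a, by omega⟩ (by omega) rfl, mergeObj_gt _ _ _ (by simpa using h)]
  · rw [insertObj_gt H x _ (Fin.succ ⟨a - 1, by omega⟩) (by simp; omega) (by simp; omega),
      insertObj_gt H _ _ ⟨a - 1, by omega⟩ (by omega) (by simp; omega),
      mergeObj_gt _ _ _ (by simp; omega)]

theorem mergeObj_insertObj_ge {n : ℕ} (i : Fin (n + 1)) (j : Fin n) (hij : i.1 ≤ j.1)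
    (x : Fin (n + 2) → C) (a : Fin (n + 2)) :
    mergeObj (insertObj H x i.castSucc) j.succ a = insertObj H (mergeObj x j) i a := by
  rcases le_or_gt a.1 i.1 with h | h
  · rw [mergeObj_lt _ _ _ (by simp; omega),
      insertObj_le H x _ (Fin.castSucc ⟨a, by omega⟩) (by simp; omega) (by simp),
      insertObj_le H _ _ ⟨a, by omega⟩ (by omega) rfl, mergeObj_lt _ _ _ (by simp; omega)]
  rcases le_or_gt a.1 (j.1 + 1) with h' | h'
  · rw [mergeObj_lt _ _ _ (by simpa using h'),
      insertObj_gt H x _ (Fin.castSucc ⟨a - 1, by omega⟩) (by simpa using h) (by simp; omega),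
      insertObj_gt H _ _ ⟨a - 1, by omega⟩ (by omega) (by simp; omega),
      mergeObj_lt _ _ _ (by simp; omega)]
  · rw [mergeObj_gt _ _ _ (by simpa using h'),
      insertObj_gt H x _ (Fin.succ ⟨a - 1, by omega⟩) (by simp; omega) (by simp; omega),
      insertObj_gt H _ _ ⟨a - 1, by omega⟩ (by omega) (by simp; omega),
      mergeObj_gt _ _ _ (by simp; omega)]

theorem mergeHom_insertHom_lt {n : ℕ} (i : Fin (n + 1)) (j : Fin n) (hij : j.1 < i.1)
    (x : Fin (n + 2) → C) (f : ∀ i : Fin (n + 1), (x i.succ ⟶ x i.castSucc)) (a : Fin (n + 1)) :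
    mergeHom (insertObj H x i.succ) (insertHom e x f i.succ) j.castSucc a ≍
      insertHom e (mergeObj x j) (mergeHom x f j) i a := by
  rcases lt_trichotomy a.1 j.1 with h | h | h
  · refine (mergeHom_lt _ _ _ _ (by simpa using h)).trans ?_
    refine (insertHom_lt (Fin.castSucc ⟨a, by omega⟩) (by simp; omega) (by simp)).trans ?_
    refine HEq.trans ?_ (insertHom_lt ⟨a, by omega⟩ (by omega) rfl).symm
    refine map_heq H ?_ ?_ (mergeHom_lt x f j ⟨a, by omega⟩ h).symm
    · exact (mergeObj_lt x j (Fin.succ ⟨a, by omega⟩) (Nat.succ_le_of_lt h)).symm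
    · exact (mergeObj_lt _ _ _ (by simp; omega)).symm
  · obtain rfl : a = j.castSucc := Fin.ext h
    refine (mergeHom_eq _ _ _ _ (by simp)).trans ?_
    refine (comp_heq (f' := H.map (f j.succ)) (h' := H.map (f j.castSucc)) ?_ ?_ ?_
      (insertHom_lt _ (by simp; omega) (by simp)) (insertHom_lt _ (by simp; omega) (by simp))).trans ?_
    · exact insertObj_le H x _ _ (by simp; omega) (by simp)
    · exact insertObj_le H x _ _ (by simp; omega) (by simp)
    · exact insertObj_le H x _ _ (by simp; omega) (by simp)
    refine HEq.trans (heq_of_eq (H.map_comp _ _).symm) ?_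
    refine HEq.trans ?_ (insertHom_lt j (by simpa using hij) rfl).symm
    refine map_heq H ?_ ?_ (mergeHom_eq x f j j rfl).symm
    · exact (mergeObj_gt _ _ _ (by simp)).symm
    · exact (mergeObj_lt _ _ _ (by simp)).symm
  refine (mergeHom_gt _ _ _ _ (by simpa using h)).trans ?_
  rcases lt_trichotomy a.1 i.1 with h' | h' | h'
  · refine (insertHom_lt (Fin.succ ⟨a, by omega⟩) (by simp; omega) (by simp)).trans ?_
    refine HEq.trans ?_ (insertHom_lt ⟨a, by omega⟩ (by omega) rfl).symm
    refine map_heq H ?_ ?_ (mergeHom_gt x f j ⟨a, by omega⟩ h).symm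
    · exact (mergeObj_gt _ _ _ (by simp; omega)).symm
    · exact (mergeObj_gt x j (Fin.castSucc ⟨a, by omega⟩) h).symm
  · refine (insertHom_eq (by simpa using h')).trans (HEq.trans ?_ (insertHom_eq h').symm)
    exact iso_hom_heq e (mergeObj_gt _ _ _ hij).symm
  · refine (insertHom_gt a (by simpa using h') (by simp)).trans ?_
    refine HEq.trans ?_ (insertHom_gt ⟨a - 1, by omega⟩ h' (by simp; omega)).symm
    refine HEq.trans ?_ (mergeHom_gt x f j ⟨a - 1, by omega⟩ (by simp; omega)).symm
    exact arrow_heq f (by simp; omega)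

theorem mergeHom_insertHom_ge {n : ℕ} (i : Fin (n + 1)) (j : Fin n) (hij : i.1 ≤ j.1)
    (x : Fin (n + 2) → C) (f : ∀ i : Fin (n + 1), (x i.succ ⟶ x i.castSucc)) (a : Fin (n + 1)) :
    mergeHom (insertObj H x i.castSucc) (insertHom e x f i.castSucc) j.succ a ≍
      insertHom e (mergeObj x j) (mergeHom x f j) i a := by
  rcases lt_trichotomy a.1 i.1 with h | h | h
  · refine (mergeHom_lt _ _ _ _ (by simp; omega)).trans ?_
    refine (insertHom_lt (Fin.castSucc ⟨a, by omega⟩) (by simpa using h) (by simp)).trans ?_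
    refine HEq.trans ?_ (insertHom_lt ⟨a, by omega⟩ h rfl).symm
    refine map_heq H ?_ ?_ (mergeHom_lt x f j ⟨a, by omega⟩ (by simp; omega)).symm
    · exact (mergeObj_lt x j (Fin.succ ⟨a, by omega⟩) (by simp; omega)).symm
    · exact (mergeObj_lt _ _ _ (by simp; omega)).symm
  · refine (mergeHom_lt _ _ _ _ (by simp; omega)).trans ?_
    refine (insertHom_eq (by simpa using h)).trans (HEq.trans ?_ (insertHom_eq h).symm)
    exact iso_hom_heq e (mergeObj_lt _ _ _ hij).symm
  refine HEq.trans ?_ (insertHom_gt ⟨a - 1, by omega⟩ h (by simp; omega)).symm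
  rcases lt_trichotomy a.1 (j.1 + 1) with h' | h' | h'
  · refine (mergeHom_lt _ _ _ _ (by simpa using h')).trans ?_
    refine HEq.trans ?_ (mergeHom_lt x f j ⟨a - 1, by omega⟩ (by simp; omega)).symm
    exact insertHom_gt _ (by simpa using h) (by simp; omega)
  · refine (mergeHom_eq _ _ _ _ (by simpa using h')).trans ?_
    refine HEq.trans ?_ (mergeHom_eq x f j ⟨a - 1, by omega⟩ (by simp; omega)).symm
    refine comp_heq ?_ ?_ ?_ (insertHom_gt _ (by simp; omega) (by simp; omega))
      (insertHom_gt _ (by simpa using h) (by simp; omega))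
    · exact insertObj_gt H x _ _ (by simp; omega) (by simp; omega)
    · exact insertObj_gt H x _ _ (by simp; omega) (by simp; omega)
    · exact insertObj_gt H x _ _ (by simp; omega) (by simp; omega)
  · refine (mergeHom_gt _ _ _ _ (by simpa using h')).trans ?_
    refine HEq.trans ?_ (mergeHom_gt x f j ⟨a - 1, by omega⟩ (by simp; omega)).symm
    exact insertHom_gt _ (by simp; omega) (by simp; omega)

theorem insertAt_dMiddle_lt {n : ℕ} (i : Fin (n + 1)) (j : Fin n) (hij : j.1 < i.1)
    (φ : Cochain k C (n + 1)) :
    insertAt e i.succ (dMiddle j.castSucc φ) = dMiddle j (insertAt e i φ) :=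
  insertAt_dMiddle_of_heq e _ _ _ _ φ (mergeObj_insertObj_lt i j hij)
    (mergeHom_insertHom_lt e i j hij)

theorem insertAt_dMiddle_ge {n : ℕ} (i : Fin (n + 1)) (j : Fin n) (hij : i.1 ≤ j.1)
    (φ : Cochain k C (n + 1)) :
    insertAt e i.castSucc (dMiddle j.succ φ) = dMiddle j (insertAt e i φ) :=
  insertAt_dMiddle_of_heq e _ _ _ _ φ (mergeObj_insertObj_ge i j hij)
    (mergeHom_insertHom_ge e i j hij)

end Homotopy

section Faces

universe w u v

/-- The alternating sum identity behind a simplicial homotopy. -/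
theorem alternating_sum_homotopy {k M : Type*} [CommRing k] [AddCommGroup M] [Module k M] {n : ℕ}
    (X : Fin (n + 1) → Fin (n + 2) → M) (Y : Fin n → Fin (n + 1) → M)
    (h_lower : ∀ i j, j.1 ≤ i.1 → X i.succ j.castSucc = Y i j)
    (h_upper : ∀ i j, i.1 < j.1 → X i.castSucc j.succ = Y i j)
    (h_diag : ∀ i : Fin n, X i.castSucc i.castSucc.succ = X i.succ i.castSucc.succ) :
    ∑ i, ∑ j, (-1 : k) ^ (i.1 + j.1) • X i j + ∑ i, ∑ j, (-1 : k) ^ (i.1 + j.1) • Y i j =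
      X 0 0 - X (Fin.last n) (Fin.last (n + 1)) := by
  have split : ∀ i : Fin (n + 1), ∑ j, (-1 : k) ^ (i.1 + j.1) • X i j =
      ∑ j, (if j.1 < i.1 then (-1 : k) ^ (i.1 + j.1) • X i j else 0) +
      ∑ j, (if i.1 + 1 < j.1 then (-1 : k) ^ (i.1 + j.1) • X i j else 0) +
      X i i.castSucc - X i i.succ := by
    intro i
    have e1 : X i i.castSucc =
        ∑ j, (if j = i.castSucc then (-1 : k) ^ (i.1 + j.1) • X i j else 0) := by
      simp [← two_mul]
    have e2 : - X i i.succ =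
        ∑ j, (if j = i.succ then (-1 : k) ^ (i.1 + j.1) • X i j else 0) := by
      simp [← add_assoc, ← two_mul, pow_succ]
    rw [sub_eq_add_neg, e1, e2, ← Finset.sum_add_distrib, ← Finset.sum_add_distrib,
      ← Finset.sum_add_distrib]
    refine Finset.sum_congr rfl fun j _ => ?_
    rcases lt_trichotomy j.1 i.1 with h | h | h
    · simp [h, Fin.ext_iff, show ¬ i.1 + 1 < j.1 by omega, h.ne, show j.1 ≠ i.1 + 1 by omega]
    · simp [h, Fin.ext_iff]
    · rcases eq_or_ne j.1 (i.1 + 1) with h' | h'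
      · simp [h', Fin.ext_iff]
      · simp [Fin.ext_iff, h', h.ne', h.not_gt, show i.1 + 1 < j.1 by omega]
  have lower : ∑ i : Fin (n + 1), ∑ j : Fin (n + 2),
        (if j.1 < i.1 then (-1 : k) ^ (i.1 + j.1) • X i j else 0) =
      - ∑ i : Fin n, ∑ j : Fin (n + 1),
        (if j.1 ≤ i.1 then (-1 : k) ^ (i.1 + j.1) • Y i j else 0) := by
    rw [Fin.sum_univ_succ, ← Finset.sum_neg_distrib]
    simp only [Fin.val_zero, not_lt_zero, if_false, Finset.sum_const_zero, zero_add]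
    refine Finset.sum_congr rfl fun i _ => ?_
    rw [Fin.sum_univ_castSucc, if_neg (by simp), add_zero, ← Finset.sum_neg_distrib]
    refine Finset.sum_congr rfl fun j _ => ?_
    by_cases h : j.1 ≤ i.1
    · rw [if_pos (by simpa using Nat.lt_succ_of_le h), if_pos h, h_lower i j h, Fin.val_succ,
        Fin.val_castSucc, show i.1 + 1 + j.1 = i.1 + j.1 + 1 by omega, pow_succ]
      simp
    · rw [if_neg (by simp; omega), if_neg h, neg_zero]
  have upper : ∑ i : Fin (n + 1), ∑ j : Fin (n + 2),
        (if i.1 + 1 < j.1 then (-1 : k) ^ (i.1 + j.1) • X i j else 0) =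
      - ∑ i : Fin n, ∑ j : Fin (n + 1),
        (if i.1 < j.1 then (-1 : k) ^ (i.1 + j.1) • Y i j else 0) := by
    rw [Fin.sum_univ_castSucc, ← Finset.sum_neg_distrib, Finset.sum_eq_zero (s := Finset.univ)
      (f := fun j : Fin (n + 2) => if (Fin.last n).1 + 1 < j.1 then _ else _)
      (fun j _ => if_neg (by simp; omega)), add_zero]
    refine Finset.sum_congr rfl fun i _ => ?_
    rw [Fin.sum_univ_succ, if_neg (by simp), zero_add, ← Finset.sum_neg_distrib]
    refine Finset.sum_congr rfl fun j _ => ?_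
    by_cases h : i.1 < j.1
    · rw [if_pos (by simpa using h), if_pos h, h_upper i j h, Fin.val_succ,
        Fin.val_castSucc, ← add_assoc, pow_succ]
      simp
    · rw [if_neg (by simpa using h), if_neg h, neg_zero]
  have both : ∑ i : Fin n, ∑ j : Fin (n + 1), (-1 : k) ^ (i.1 + j.1) • Y i j =
      ∑ i : Fin n, ∑ j : Fin (n + 1),
        (if j.1 ≤ i.1 then (-1 : k) ^ (i.1 + j.1) • Y i j else 0) +
      ∑ i : Fin n, ∑ j : Fin (n + 1),
        (if i.1 < j.1 then (-1 : k) ^ (i.1 + j.1) • Y i j else 0) := by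
    simp only [← Finset.sum_add_distrib]
    refine Finset.sum_congr rfl fun i _ => Finset.sum_congr rfl fun j _ => ?_
    by_cases h : j.1 ≤ i.1
    · simp [h, h.not_gt]
    · simp [h, not_le.1 h]
  have diag : ∑ i : Fin (n + 1), X i i.castSucc - ∑ i : Fin (n + 1), X i i.succ =
      X 0 0 - X (Fin.last n) (Fin.last (n + 1)) := by
    rw [Fin.sum_univ_succ, Fin.sum_univ_castSucc (fun i => X i i.succ)]
    have h : ∑ i : Fin n, X i.castSucc i.castSucc.succ = ∑ i : Fin n, X i.succ i.succ.castSucc :=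
      Finset.sum_congr rfl fun i _ => h_diag i
    rw [h, Fin.succ_last, Fin.castSucc_zero]
    abel
  simp only [split, Finset.sum_add_distrib, Finset.sum_sub_distrib]
  rw [lower, upper, both, ← diag]
  abel

variable {k : Type w} [CommRing k] {C : Type u} [Category.{v} C] [Preadditive C] [Linear k C]

/-- The faces of the cosimplicial module of cochains. -/
def face {n : ℕ} (j : Fin (n + 2)) : Cochain k C n →ₗ[k] Cochain k C (n + 1) :=
  Fin.cases (dLeftₗ n) (fun j => Fin.lastCases (dRightₗ n) (fun j => dMiddleₗ j) j) j

theorem face_zero {n : ℕ} (φ : Cochain k C n) : face 0 φ = dLeft φ := rfl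

theorem face_succ_castSucc {n : ℕ} (j : Fin n) (φ : Cochain k C n) :
    face j.castSucc.succ φ = dMiddle j φ := by
  simp [face, dMiddleₗ_apply]

theorem face_last {n : ℕ} (φ : Cochain k C n) : face (Fin.last (n + 1)) φ = dRight φ := by
  change (Fin.lastCases (motive := fun _ => Cochain k C n →ₗ[k] Cochain k C (n + 1)) (dRightₗ n)
    (fun j => dMiddleₗ j) (Fin.last n)) φ = _
  rw [Fin.lastCases_last, dRightₗ_apply]

theorem d_eq_sum_face {n : ℕ} (φ : Cochain k C n) :
    d k C n φ = (-1 : k) ^ (n + 1) • ∑ j : Fin (n + 2), (-1 : k) ^ j.1 • face j φ := by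
  rw [d_eq, Fin.sum_univ_succ, Fin.sum_univ_castSucc, Fin.succ_last, face_last, face_zero]
  simp only [face_succ_castSucc, smul_add, smul_smul, Finset.smul_sum, ← pow_add]
  have e : ∀ j : Fin n, (-1 : k) ^ (n + 1 + j.castSucc.succ.1) = (-1 : k) ^ (n - j.1) := by
    intro j
    rw [Fin.val_succ, Fin.val_castSucc,
      show n + 1 + (j.1 + 1) = n - j.1 + 2 * (j.1 + 1) by omega, pow_add, pow_mul]
    simp
  simp only [e, Fin.val_last, Fin.val_zero, add_zero, ← two_mul, pow_mul]
  simp [add_assoc]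

variable {H : C ⥤ C} (e : ∀ x, x ≅ H.obj x) [H.Additive] [H.Linear k]

/-- A functor isomorphic to the identity acts trivially in cohomology. -/
theorem sub_mem_coboundaries_of_lifts
    (he : ∀ {x y : C} (f : x ⟶ y), f ≫ (e y).hom = (e x).hom ≫ H.map f) {n : ℕ} {φ' φ : Cochain k C n} (h : Lifts H φ' φ)
    (hφ : φ ∈ cocycles k C n) : φ - φ' ∈ coboundaries k C n := by
  have hd : ∑ j : Fin (n + 2), (-1 : k) ^ j.1 • face j φ = 0 := by
    have h0 : d k C n φ = 0 := hφ
    rw [d_eq_sum_face] at h0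
    simpa [smul_smul, ← mul_pow] using congrArg (fun z => (-1 : k) ^ (n + 1) • z) h0
  have hX : ∑ i : Fin (n + 1), ∑ j : Fin (n + 2),
      (-1 : k) ^ (i.1 + j.1) • insertAt e i (face j φ) = 0 := by
    refine Finset.sum_eq_zero fun i _ => ?_
    have := congrArg (fun z => (-1 : k) ^ i.1 • insertAt e i z) hd
    simpa [map_sum, Finset.smul_sum, smul_smul, ← pow_add] using this
  have h_first : insertAt e 0 (face 0 φ) = φ := insertAt_zero_dLeft e φ
  have h_last : insertAt e (Fin.last n) (face (Fin.last (n + 1)) φ) = φ' := by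
    rw [face_last, insertAt_last_dRight e he h]
  have h_diag : ∀ i : Fin n, insertAt e i.castSucc (face i.castSucc.succ φ) =
      insertAt e i.succ (face i.castSucc.succ φ) := by
    intro i
    rw [face_succ_castSucc, insertAt_dMiddle_self e he]
  cases n with
  | zero =>
    have := alternating_sum_homotopy (k := k) (fun i j => insertAt e i (face j φ))
      (fun i _ => i.elim0) (fun i => i.elim0) (fun i => i.elim0) h_diag
    rw [hX, h_first, h_last] at this
    rw [← this]
    simp
  | succ n =>
    have := alternating_sum_homotopy (k := k) (fun i j => insertAt e i (face j φ))
      (fun i j => face j (insertAt e i φ)) ?_ ?_ h_diag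
    · rw [hX, h_first, h_last, zero_add] at this
      refine ⟨(-1 : k) ^ (n + 1) • ∑ i : Fin (n + 1), (-1 : k) ^ i.1 • insertAt e i φ, ?_⟩
      rw [map_smul, d_eq_sum_face, smul_smul, ← mul_pow, ← this, Finset.sum_comm]
      simp only [map_sum, map_smul, Finset.smul_sum, smul_smul, ← pow_add, add_comm]
      simp
    · intro i j hij
      refine Fin.cases (fun _ => ?_) (fun j hij => ?_) j hij
      · exact insertAt_dLeft e he i φ
      · refine Fin.lastCases (fun hij => ?_) (fun j hij => ?_) j hij
        · simp at hij; omega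
        · rw [face_succ_castSucc, ← Fin.succ_castSucc, face_succ_castSucc]
          exact insertAt_dMiddle_lt e i j (by simpa using hij) φ
    · intro i j hij
      refine Fin.cases (fun hij => ?_) (fun j hij => ?_) j hij
      · simp at hij
      · refine Fin.lastCases (fun hij => ?_) (fun j hij => ?_) j hij
        · rw [Fin.succ_last, Fin.succ_last, face_last, face_last]
          exact insertAt_dRight e i φ
        · rw [face_succ_castSucc, Fin.succ_castSucc, face_succ_castSucc]
          exact insertAt_dMiddle_ge e i j (by simpa using Nat.le_of_lt_succ hij) φ

end Faces

section Equivalences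

universe w g u₁ v₁ u₂ v₂

variable {k : Type w} [CommRing k] {C : Type u₁} [Category.{v₁} C] [Preadditive C] [Linear k C]
  {D : Type u₂} [Category.{v₂} D] [Preadditive D] [Linear k D]

theorem cochainMap_lifts (F : C ⥤ D) [F.Additive] [F.Linear k] [F.Full] [F.Faithful] {n : ℕ}
    (φ : Cochain k D n) : Lifts F (cochainMap k F n φ) φ := fun x f =>
  (homIso k F (x (Fin.last n)) (x 0)).apply_symm_apply _

theorem Lifts.comp {F : C ⥤ D} {E : D ⥤ C} {n : ℕ} {φ'' : Cochain k D n} {φ' : Cochain k C n}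
    {φ : Cochain k D n} (h : Lifts E φ'' φ') (h' : Lifts F φ' φ) : Lifts (E ⋙ F) φ'' φ := by
  intro x f
  change F.map (E.map (φ'' x f)) = _
  rw [h x f, h']
  rfl

section

variable (F : C ⥤ D) [F.Additive] [F.Linear k] [F.Full] [F.Faithful]

theorem d_cochainMap (n : ℕ) (φ : Cochain k D n) :
    cochainMap k F (n + 1) (d k D n φ) = d k C n (cochainMap k F n φ) :=
  (cochainMap_lifts F _).unique (cochainMap_lifts F φ).d

theorem cochainMap_one : cochainMap k F 0 (cupOne k D) = cupOne k C :=
  (cochainMap_lifts F _).unique (Lifts.one F)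

theorem cochainMap_cup (m n : ℕ) (ψ : Cochain k D m) (φ : Cochain k D n) :
    cochainMap k F (m + n) (cup ψ φ) = cup (cochainMap k F m ψ) (cochainMap k F n φ) :=
  (cochainMap_lifts F _).unique ((cochainMap_lifts F ψ).cup (cochainMap_lifts F φ))

variable (k) in
/-- The algebra map in cohomology induced by a fully faithful `k`-functor. -/
def HH.map : HH k D →ₐ[k] HH k C :=
  mapHH (cochainMap k F) (d_cochainMap F) (cochainMap_one F) (cochainMap_cup F)

theorem HH.map_cls {n : ℕ} (z : cocycles k D n) :
    HH.map k F (HH.cls z) = HH.cls (mapZ (cochainMap k F) (d_cochainMap F) n z) :=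
  mapHH_cls _ (d_cochainMap F) (cochainMap_one F) (cochainMap_cup F) z

theorem HH.cls_eq {n : ℕ} {z z' : cocycles k C n}
    (h : (z : Cochain k C n) - z' ∈ coboundaries k C n) : HH.cls z = HH.cls z' := by
  refine congrArg (DirectSum.of (HHn k C) n) (sub_eq_zero.1 ?_)
  rw [← map_sub]
  exact HHn.mk_eq_zero _ h

theorem HH.map_comp_map (E : D ⥤ C) [E.Additive] [E.Linear k] [E.Full] [E.Faithful]
    (η : 𝟭 D ≅ E ⋙ F) : (HH.map k E).comp (HH.map k F) = AlgHom.id k (HH k D) := by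
  refine HH.algHom_ext fun n z => ?_
  change HH.map k E (HH.map k F (HH.cls z)) = HH.cls z
  rw [HH.map_cls, HH.map_cls]
  refine (HH.cls_eq ?_).symm
  exact sub_mem_coboundaries_of_lifts (fun x => η.app x) (fun {_ _} f => η.hom.naturality f)
    ((cochainMap_lifts E _).comp (cochainMap_lifts F z.1)) z.2

end

variable (k) in
/-- The isomorphism of algebras in cohomology induced by a `k`-linear equivalence. -/
def HH.mapEquiv (F : C ⥤ D) [F.Additive] [F.Linear k] [F.IsEquivalence] :
    HH k D ≃ₐ[k] HH k C :=
  haveI : F.asEquivalence.functor.Additive := inferInstanceAs F.Additive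
  haveI : F.asEquivalence.functor.Linear k := inferInstanceAs (F.Linear k)
  AlgEquiv.ofAlgHom (HH.map k F) (HH.map k F.asEquivalence.inverse)
    (HH.map_comp_map F.asEquivalence.inverse F F.asEquivalence.unitIso)
    (HH.map_comp_map F F.asEquivalence.inverse F.asEquivalence.counitIso.symm)

variable {G : Type g} [Group G] [MulAction G C] [GkCategory k G C] [MulAction G D]
  [GkCategory k G D]

theorem IsGFunctor.map_hom_heq {F : C ⥤ D} (hF : IsGFunctor k G F) (s : G) {x y : C}
    (f : x ⟶ y) : F.map (hom k s f) ≍ hom k s (F.map f) := by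
  rw [hF.map_hom, eqToHom_comp_heq_iff]
  exact comp_eqToHom_heq _ _

theorem Lifts.cochainAct {F : C ⥤ D} (hF : IsGFunctor k G F) (s : G) {n : ℕ}
    {φ' : Cochain k C n} {φ : Cochain k D n} (h : Lifts F φ' φ) :
    Lifts F (HochschildMitchell.cochainAct k C s n φ') (HochschildMitchell.cochainAct k D s n φ) := by
  intro x f
  refine eq_of_heq (HEq.trans ?_ (cochainAct_heq s φ _ _).symm)
  refine (map_heq F (smul_inv_smul s _).symm (smul_inv_smul s _).symm
    (cochainAct_heq s φ' x f)).trans ?_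
  refine (hF.map_hom_heq s _).trans (hom_heq s (hF.obj_smul _ _) (hF.obj_smul _ _) ?_)
  rw [h]
  exact cochain_heq φ (fun i => hF.obj_smul _ _) fun i => hF.map_hom_heq _ _

theorem cochainMap_cochainAct (F : C ⥤ D) [F.Additive] [F.Linear k] [F.Full] [F.Faithful]
    (hF : IsGFunctor k G F) (s : G) (n : ℕ) (φ : Cochain k D n) :
    cochainMap k F n (cochainAct k D s n φ) = cochainAct k C s n (cochainMap k F n φ) :=
  (cochainMap_lifts F _).unique ((cochainMap_lifts F φ).cochainAct hF s)

theorem HH.map_act (F : C ⥤ D) [F.Additive] [F.Linear k] [F.Full] [F.Faithful]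
    (hF : IsGFunctor k G F) (s : G) :
    (HH.map k F).comp (HH.act k D s) = (HH.act k C s).comp (HH.map k F) := by
  refine HH.algHom_ext fun n z => ?_
  change HH.map k F (HH.act k D s (HH.cls z)) = HH.act k C s (HH.map k F (HH.cls z))
  rw [HH.act_cls, HH.map_cls, HH.map_cls, HH.act_cls]
  exact congrArg HH.cls (Subtype.ext (cochainMap_cochainAct F hF s n z.1))

end Equivalences

end HochschildMitchell

end

theorem mainTheorem12 {k : Type*} [Field k] {G : Type*} [Group G]
    {C : Type*} [Category* C] [Preadditive C] [Linear k C] [MulAction G C]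
    [HochschildMitchell.GkCategory k G C]
    {D : Type*} [Category* D] [Preadditive D] [Linear k D] [MulAction G D]
    [HochschildMitchell.GkCategory k G D]
    (F : C ⥤ D) [F.Additive] [F.Linear k] [F.IsEquivalence]
    (hF : HochschildMitchell.IsGFunctor k G F) :
    (∀ (n : ℕ) (φ : HochschildMitchell.Cochain k D n),
      HochschildMitchell.cochainMap k F (n + 1) (HochschildMitchell.d k D n φ) =
        HochschildMitchell.d k C n (HochschildMitchell.cochainMap k F n φ)) ∧
    HochschildMitchell.cochainMap k F 0 (HochschildMitchell.cupOne k D) =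
      HochschildMitchell.cupOne k C ∧
    (∀ (m n : ℕ) (ψ : HochschildMitchell.Cochain k D m) (φ : HochschildMitchell.Cochain k D n),
      HochschildMitchell.cochainMap k F (m + n) (HochschildMitchell.cup ψ φ) =
        HochschildMitchell.cup (HochschildMitchell.cochainMap k F m ψ)
          (HochschildMitchell.cochainMap k F n φ)) ∧
    (∀ (s : G) (n : ℕ) (φ : HochschildMitchell.Cochain k D n),
      HochschildMitchell.cochainMap k F n (HochschildMitchell.cochainAct k D s n φ) =
        HochschildMitchell.cochainAct k C s n (HochschildMitchell.cochainMap k F n φ)) ∧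
    ∃ Φ : HochschildMitchell.HH k D ≃ₐ[k] HochschildMitchell.HH k C,
      (∀ (n : ℕ) (z : HochschildMitchell.cocycles k D n),
        ∃ hz : HochschildMitchell.cochainMap k F n z ∈ HochschildMitchell.cocycles k C n,
          Φ (HochschildMitchell.HH.cls z) =
            HochschildMitchell.HH.cls ⟨HochschildMitchell.cochainMap k F n z, hz⟩) ∧
      ∀ (s : G) (a : HochschildMitchell.HH k D),
        Φ (HochschildMitchell.HH.action k G D s a) =
          HochschildMitchell.HH.action k G C s (Φ a) := by
  open HochschildMitchell in
  refine ⟨d_cochainMap F, cochainMap_one F, cochainMap_cup F, cochainMap_cochainAct F hF,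
    HH.mapEquiv k F, fun n z => ⟨map_mem_cocycles _ (d_cochainMap F) z.2, HH.map_cls F z⟩,
    fun s a => DFunLike.congr_fun (HH.map_act F hF s) a⟩
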